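/- Let $n\ge 0$ be an integer and $p>0$ real. On $\mathbb{C}^n$ let $|z|$ be the Euclidean norm, for $\tau>0$ put $\|f\|_{p,\tau}=\sup_{z}|f(z)|\exp(-\tau|z|^p)$, let $A_{p,\tau}$ be the normed space of entire functions $f$ on $\mathbb{C}^n$ with $\|f\|_{p,\tau}<\infty$, and let $A_p=\bigcup_{\tau>0}A_{p,\tau}$ with the locally convex inductive limit topology (the finest locally convex vector space topology for which all inclusions $A_{p,\tau}\to A_p$ are continuous). For $\alpha,\beta\in\mathbb{Z}_{\ge0}^n$ use the usual multi-index notation ($|\alpha|=\sum_j\alpha_j$, $\alpha!=\prod_j\alpha_j!$, componentwise order, $\partial^\alpha=\prod_j(\partial/\partial z_j)^{\alpha_j}$), with $0^0=1$, and put $1/q=1-1/p$. Consider formal differential operators $P=\sum_{\alpha}a_\alpha(z)\partial^\alpha$ with entire coefficients $a_\alpha$, and the following conditions: for every $\varepsilon>0$ there exist $B>0$ and $C>0$ such that (I) $|a_\alpha(z)|\le C\,\dfrac{\varepsilon^{|\alpha|}}{|\alpha|!^{1/q}}\exp(B|z|^p)$ for all $z\in\mathbb{C}^n$ and all $\alpha$;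 (II) $|a_\alpha(z)|\le C\,\dfrac{|\alpha|^{|\alpha|/p}}{\alpha!}\,\varepsilon^{|\alpha|}\exp(B|z|^p)$ for all $z\in\mathbb{C}^n$ and all $\alpha$; (III) $\|a_\alpha\|_{p,B}\le C\,\dfrac{\varepsilon^{|\alpha|}}{|\alpha|!^{1/q}}$ for all $\alpha$; (IV) $\|a_\alpha\|_{p,B}\le C\,\dfrac{|\alpha|^{|\alpha|/p}}{\alpha!}\,\varepsilon^{|\alpha|}$ for all $\alpha$. These four conditions are equivalent. Let $\boldsymbol{D}_p$ be the set of all such $P$ satisfying one of them. Then: (i) If $P=\sum_\alpha a_\alpha\partial^\alpha\in\boldsymbol{D}_p$, then for every $f\in A_p$ all the functions $a_\alpha\partial^\alpha f$ belong to $A_p$, and the series $Pf:=\sum_\alpha a_\alpha\,\partial^\alpha f$ converges unconditionally both pointwise and in the topology of $A_p$, so that $Pf\in A_p$. The map $f\mapsto Pf$ is a continuous linear operator $A_p\to A_p$. (ii) Conversely, for every continuous linear operator $F:A_p\to A_p$ there is a unique $P\in\boldsymbol{D}_p$ such that $Ff=Pf$ for all $f\in A_p$. Its coefficients are $$a_\alpha(z)=\sum_{\beta\le\alpha}\frac{(-z)^{\alpha-\beta}}{(\alpha-\beta)!\,\beta!}\,(Fz^\beta)(z).$$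 -/

import Mathlib

noncomputable section

/-- The space `ℂⁿ` with its Euclidean norm. -/
abbrev Cn (n : ℕ) : Type := EuclideanSpace ℂ (Fin n)

/-- Multi-indices `α = (α₁, …, αₙ)`; the order `β ≤ α` is the componentwise one. -/
abbrev MIdx (n : ℕ) : Type := Fin n → ℕ

/-- The length `|α| = α₁ + ⋯ + αₙ`. -/
def MIdx.len {n : ℕ} (α : MIdx n) : ℕ := ∑ j, α j

/-- The factorial `α! = α₁! ⋯ αₙ!`. -/
def MIdx.fact {n : ℕ} (α : MIdx n) : ℕ := ∏ j, (α j).factorial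

/-- The monomial `z^α = z₁^α₁ ⋯ zₙ^αₙ`. -/
def zpowIdx {n : ℕ} (z : Cn n) (α : MIdx n) : ℂ := ∏ j, z j ^ α j

/-- The partial derivative `∂f/∂z_j`. -/
def partialD {n : ℕ} (j : Fin n) (f : Cn n → ℂ) : Cn n → ℂ :=
  fun z => fderiv ℂ f z (EuclideanSpace.single j 1)

/-- The iterated derivative `∂^α f = (∂/∂z₁)^α₁ ⋯ (∂/∂zₙ)^αₙ f`. -/
def iterD {n : ℕ} (α : MIdx n) (f : Cn n → ℂ) : Cn n → ℂ :=
  (List.finRange n).foldr (fun j g => (partialD j)^[α j] g) f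

/-- The weighted values `|f(z)| exp(-τ|z|^p)`. -/
def weighted {n : ℕ} (p τ : ℝ) (f : Cn n → ℂ) (z : Cn n) : ℝ :=
  ‖f z‖ * Real.exp (-(τ * ‖z‖ ^ p))

/-- The `(p,τ)`-norm, `sup_z |f(z)| exp(-τ|z|^p)`; it is only used for functions for which
the supremum is finite. -/
def ptNorm {n : ℕ} (p τ : ℝ) (f : Cn n → ℂ) : ℝ := ⨆ z, weighted p τ f z

/-- The entire functions with finite `(p,τ)`-norm, as a vector space of functions. -/
def submoduleA (n : ℕ) (p τ : ℝ) : Submodule ℂ (Cn n → ℂ) where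
  carrier := {f | Differentiable ℂ f ∧ BddAbove (Set.range (weighted p τ f))}
  zero_mem' := by
    refine ⟨differentiable_const 0, 0, ?_⟩
    rintro _ ⟨z, rfl⟩
    simp [weighted]
  add_mem' := by
    rintro f g ⟨hf, M, hM⟩ ⟨hg, N, hN⟩
    refine ⟨hf.add hg, M + N, ?_⟩
    rintro _ ⟨z, rfl⟩
    have h1 := hM ⟨z, rfl⟩
    have h2 := hN ⟨z, rfl⟩
    simp only [weighted, Pi.add_apply] at h1 h2 ⊢
    have := mul_le_mul_of_nonneg_right (norm_add_le (f z) (g z))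
      (Real.exp_pos (-(τ * ‖z‖ ^ p))).le
    linarith
  smul_mem' := by
    rintro c f ⟨hf, M, hM⟩
    refine ⟨hf.const_smul c, ‖c‖ * M, ?_⟩
    rintro _ ⟨z, rfl⟩
    have h1 := hM ⟨z, rfl⟩
    simp only [weighted, Pi.smul_apply, norm_smul] at h1 ⊢
    rw [mul_assoc]
    exact mul_le_mul_of_nonneg_left h1 (norm_nonneg c)

theorem submoduleA_mono {n : ℕ} {p τ τ' : ℝ} (h : τ ≤ τ') :
    submoduleA n p τ ≤ submoduleA n p τ' := by
  rintro f ⟨hf, M, hM⟩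
  refine ⟨hf, M, ?_⟩
  rintro _ ⟨z, rfl⟩
  refine le_trans ?_ (hM ⟨z, rfl⟩)
  simp only [weighted]
  have : τ * ‖z‖ ^ p ≤ τ' * ‖z‖ ^ p :=
    mul_le_mul_of_nonneg_right h (Real.rpow_nonneg (norm_nonneg z) p)
  gcongr

/-- The space `A_{p,τ}`, to be normed by the `(p,τ)`-norm. -/
def BanachA (n : ℕ) (p τ : ℝ) : Type := ↥(submoduleA n p τ)

namespace BanachA

variable {n : ℕ} {p τ : ℝ}

instance : AddCommGroup (BanachA n p τ) := inferInstanceAs (AddCommGroup ↥(submoduleA n p τ))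

instance : Module ℂ (BanachA n p τ) := inferInstanceAs (Module ℂ ↥(submoduleA n p τ))

instance : FunLike (BanachA n p τ) (Cn n) ℂ where
  coe f := f.1
  coe_injective _ _ h := Subtype.ext h

instance : Norm (BanachA n p τ) := ⟨fun f => ptNorm p τ f⟩

theorem weighted_le_norm (f : BanachA n p τ) (z : Cn n) : weighted p τ f z ≤ ‖f‖ :=
  le_ciSup f.2.2 z

theorem normCore : NormedSpace.Core ℂ (BanachA n p τ) where
  norm_nonneg f := Real.iSup_nonneg fun z =>
    mul_nonneg (norm_nonneg _) (Real.exp_pos _).le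
  norm_smul c f := by
    change (⨆ z, weighted p τ (fun z => c * f z) z) = ‖c‖ * ⨆ z, weighted p τ f z
    rw [Real.mul_iSup_of_nonneg (norm_nonneg c)]
    simp only [weighted, norm_mul, mul_assoc]
  norm_triangle f g := by
    refine ciSup_le fun z => ?_
    have h1 := weighted_le_norm f z
    have h2 := weighted_le_norm g z
    change ‖f z + g z‖ * _ ≤ _
    simp only [weighted] at h1 h2
    have := mul_le_mul_of_nonneg_right (norm_add_le (f z) (g z))
      (Real.exp_pos (-(τ * ‖z‖ ^ p))).le
    linarith
  norm_eq_zero_iff f := by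
    constructor
    · intro h
      refine DFunLike.ext _ _ fun z => ?_
      have h1 := weighted_le_norm f z
      rw [h] at h1
      simp only [weighted] at h1
      have h2 : ‖f z‖ ≤ 0 := nonpos_of_mul_nonpos_left h1 (Real.exp_pos _)
      exact norm_le_zero_iff.1 h2
    · rintro rfl
      change (⨆ z, weighted p τ (fun _ => (0 : ℂ)) z) = 0
      simp [weighted]

instance : NormedAddCommGroup (BanachA n p τ) := NormedAddCommGroup.ofCore normCore

instance : NormedSpace ℂ (BanachA n p τ) := NormedSpace.ofCore normCore

end BanachA

/-- The union over `τ > 0` of the spaces `A_{p,τ}`, as a vector space of functions. -/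
def submoduleAUnion (n : ℕ) (p : ℝ) : Submodule ℂ (Cn n → ℂ) where
  carrier := {f | ∃ τ : ℝ, 0 < τ ∧ f ∈ submoduleA n p τ}
  zero_mem' := ⟨1, one_pos, Submodule.zero_mem _⟩
  add_mem' := by
    rintro f g ⟨τ, hτ, hf⟩ ⟨σ, _, hg⟩
    exact ⟨max τ σ, lt_max_of_lt_left hτ, Submodule.add_mem _
      (submoduleA_mono (le_max_left τ σ) hf) (submoduleA_mono (le_max_right τ σ) hg)⟩
  smul_mem' := by
    rintro c f ⟨τ, hτ, hf⟩
    exact ⟨τ, hτ, Submodule.smul_mem _ c hf⟩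

/-- The space `A_p` of entire functions of order at most `p` of normal type. -/
def SpaceA (n : ℕ) (p : ℝ) : Type := ↥(submoduleAUnion n p)

namespace SpaceA

variable {n : ℕ} {p : ℝ}

instance : AddCommGroup (SpaceA n p) := inferInstanceAs (AddCommGroup ↥(submoduleAUnion n p))

instance : Module ℂ (SpaceA n p) := inferInstanceAs (Module ℂ ↥(submoduleAUnion n p))

instance : FunLike (SpaceA n p) (Cn n) ℂ where
  coe f := f.1
  coe_injective _ _ h := Subtype.ext h

/-- The inclusion `A_{p,τ} → A_p`, for `τ > 0`. -/
def incl {τ : ℝ} (hτ : 0 < τ) : BanachA n p τ →ₗ[ℂ] SpaceA n p where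
  toFun f := ⟨f.1, τ, hτ, f.2⟩
  map_add' _ _ := rfl
  map_smul' _ _ := rfl

/-- The locally convex inductive limit topology on `A_p`: the finest locally convex vector space
topology for which all the inclusions `A_{p,τ} → A_p`, `τ > 0`, are continuous. -/
instance : TopologicalSpace (SpaceA n p) :=
  sInf {t | @IsTopologicalAddGroup (SpaceA n p) t _ ∧ @ContinuousSMul ℂ (SpaceA n p) _ _ t ∧
    @LocallyConvexSpace ℝ (SpaceA n p) _ _ _ _ t ∧
    ∀ (τ : ℝ) (hτ : 0 < τ), @Continuous (BanachA n p τ) (SpaceA n p) _ t (incl hτ)}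

end SpaceA

theorem zpowIdx_mem {n : ℕ} {p : ℝ} (hp : 0 < p) (β : MIdx n) :
    (fun z => zpowIdx z β) ∈ submoduleAUnion n p := by
  obtain ⟨m, hm⟩ := exists_nat_ge ((β.len : ℝ) / p)
  refine ⟨1, one_pos, ?_, (m.factorial : ℝ), ?_⟩
  · unfold zpowIdx
    fun_prop
  · rintro _ ⟨z, rfl⟩
    have h0 : ‖zpowIdx z β‖ ≤ ‖z‖ ^ β.len := by
      rw [zpowIdx, norm_prod, MIdx.len, ← Finset.prod_pow_eq_pow_sum]
      refine Finset.prod_le_prod (fun _ _ => norm_nonneg _) fun j _ => ?_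
      rw [norm_pow]
      exact pow_le_pow_left₀ (norm_nonneg _) (PiLp.norm_apply_le z j) _
    have hx : 0 ≤ ‖z‖ ^ p := Real.rpow_nonneg (norm_nonneg z) p
    have h1 : ‖z‖ ^ β.len ≤ m.factorial * Real.exp (‖z‖ ^ p) := by
      have hf : (1 : ℝ) ≤ m.factorial := by exact_mod_cast m.factorial_pos
      rcases le_total ‖z‖ 1 with hz | hz
      · calc ‖z‖ ^ β.len ≤ 1 := pow_le_one₀ (norm_nonneg z) hz
          _ = 1 * 1 := by ring
          _ ≤ _ := mul_le_mul hf (Real.one_le_exp hx) zero_le_one (by positivity)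
      · have h2 := Real.pow_div_factorial_le_exp _ hx m
        rw [div_le_iff₀ (by positivity)] at h2
        calc ‖z‖ ^ β.len = ‖z‖ ^ (β.len : ℝ) := (Real.rpow_natCast _ _).symm
          _ ≤ ‖z‖ ^ (p * m) := Real.rpow_le_rpow_of_exponent_le hz (by
              rw [div_le_iff₀ hp] at hm
              linarith)
          _ = (‖z‖ ^ p) ^ m := by rw [Real.rpow_mul (norm_nonneg z), Real.rpow_natCast]
          _ ≤ _ := by linarith
    simp only [weighted, one_mul, Real.exp_neg]
    rw [← div_eq_mul_inv, div_le_iff₀ (Real.exp_pos _)]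
    exact h0.trans h1

/-- The monomial `z^β` as an element of `A_p`. -/
def SpaceA.monomial {n : ℕ} {p : ℝ} (hp : 0 < p) (β : MIdx n) : SpaceA n p :=
  ⟨fun z => zpowIdx z β, zpowIdx_mem hp β⟩

/-- Condition (I). Here `1 - 1 / p` is `1 / q`, also for `p = 1`, where `1 / q = 0`. -/
def GrowthI {n : ℕ} (p : ℝ) (a : MIdx n → Cn n → ℂ) : Prop :=
  ∀ ε : ℝ, 0 < ε → ∃ B C : ℝ, 0 < B ∧ 0 < C ∧ ∀ (z : Cn n) (α : MIdx n),
    ‖a α z‖ ≤ C * (ε ^ α.len / (α.len.factorial : ℝ) ^ (1 - 1 / p)) * Real.exp (B * ‖z‖ ^ p)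

/-- Condition (II). -/
def GrowthII {n : ℕ} (p : ℝ) (a : MIdx n → Cn n → ℂ) : Prop :=
  ∀ ε : ℝ, 0 < ε → ∃ B C : ℝ, 0 < B ∧ 0 < C ∧ ∀ (z : Cn n) (α : MIdx n),
    ‖a α z‖ ≤ C * ((α.len : ℝ) ^ ((α.len : ℝ) / p) / (α.fact : ℝ)) * ε ^ α.len *
      Real.exp (B * ‖z‖ ^ p)

/-- Condition (III); the membership says that the `(p,B)`-norm is finite. -/
def GrowthIII {n : ℕ} (p : ℝ) (a : MIdx n → Cn n → ℂ) : Prop :=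
  ∀ ε : ℝ, 0 < ε → ∃ B C : ℝ, 0 < B ∧ 0 < C ∧ ∀ α : MIdx n, a α ∈ submoduleA n p B ∧
    ptNorm p B (a α) ≤ C * (ε ^ α.len / (α.len.factorial : ℝ) ^ (1 - 1 / p))

/-- Condition (IV); the membership says that the `(p,B)`-norm is finite. -/
def GrowthIV {n : ℕ} (p : ℝ) (a : MIdx n → Cn n → ℂ) : Prop :=
  ∀ ε : ℝ, 0 < ε → ∃ B C : ℝ, 0 < B ∧ 0 < C ∧ ∀ α : MIdx n, a α ∈ submoduleA n p B ∧
    ptNorm p B (a α) ≤ C * ((α.len : ℝ) ^ ((α.len : ℝ) / p) / (α.fact : ℝ)) * ε ^ α.len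

/-- The set `D_p` of formal differential operators `P = ∑ a_α(z) ∂^α` with entire coefficients
that satisfy one of the conditions (I)-(IV). A formal operator is its family of coefficients. -/
structure OperatorD (n : ℕ) (p : ℝ) where
  /-- The coefficient functions `a_α`. -/
  coeff : MIdx n → Cn n → ℂ
  entire : ∀ α, Differentiable ℂ (coeff α)
  growth : GrowthI p coeff ∨ GrowthII p coeff ∨ GrowthIII p coeff ∨ GrowthIV p coeff

/-- `Pf = g` pointwise: for every `z`, the series `∑ a_α(z) ∂^α f(z)` converges (unconditionally,
hence absolutely) to `g(z)`. -/
def OperatorD.SumsPointwise {n : ℕ} {p : ℝ} (P : OperatorD n p) (f g : SpaceA n p) : Prop :=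
  ∀ z, HasSum (fun α : MIdx n => P.coeff α z * iterD α f z) (g z)

/-- `Pf = g` in `A_p`: all terms `a_α ∂^α f` belong to `A_p`, and their series converges
(unconditionally) to `g` in the topology of `A_p`. -/
def OperatorD.SumsInA {n : ℕ} {p : ℝ} (P : OperatorD n p) (f g : SpaceA n p) : Prop :=
  ∃ t : MIdx n → SpaceA n p, (∀ α z, t α z = P.coeff α z * iterD α f z) ∧ HasSum t g

end

/-! ### Cauchy estimates on a normed space, and holomorphy of series and of directional derivatives.
-/

noncomputable section

/-! Everything rests on two dual estimates with the weight `W_k = k^(k/p)` (`powWeight`). If `|f| ≤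
M exp(τ|w|^p)`, Cauchy's inequality with radius about `|α|^(1/p)` bounds `∂^α f(z)` by `M (α!/W_|α|)
K^|α|` times an exponential (`exists_norm_iterD_le`). Conversely, for every `δ > 0` the monomial `(w
- z)^α` has norm at most `2 δ^|α| W_|α| exp(t|z|^p)` in a step `A_{p,t}` with `t` depending on `δ`
(`norm_shiftPow_le`).

Since condition (II) allows an arbitrarily small `ε`, the factor `K^|α|` is beaten, and `∑ a_α ∂^α
f` converges geometrically in one step; this gives (i).

For (ii), the Taylor series of `f` at `z` converges to `f` in `A_p` (`SpaceA.hasSum_taylor`).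
Applying `F` and evaluating at `z` gives `Ff(z) = ∑ a_α(z) ∂^α f(z)` with `a_α(z) = F((w - z)^α)(z)
/ α!`. The binomial theorem turns this into the stated formula, and testing on `(w - z)^α` gives
uniqueness. The growth of `a_α` requires that `F` map each step boundedly into a single step
(`SpaceA.exists_bound_of_continuous`); a gliding-sequence argument proves this directly from the
universal property of the inductive limit. -/

theorem Differentiable.norm_fderiv_apply_le {E : Type*} [NormedAddCommGroup E] [NormedSpace ℂ E]
    {f : E → ℂ} (hf : Differentiable ℂ f) {z v : E} {R M : ℝ} (hR : 0 < R)
    (h : ∀ s : ℂ, ‖s‖ = R → ‖f (z + s • v)‖ ≤ M) : ‖fderiv ℂ f z v‖ ≤ M / R := by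
  have h1 : HasDerivAt (fun s : ℂ => f (z + s • v)) (fderiv ℂ f z v) 0 := by
    have h2 : HasDerivAt (fun s : ℂ => z + s • v) v 0 := by
      simpa using ((hasDerivAt_id (0 : ℂ)).smul_const v).const_add z
    have h3 : HasFDerivAt f (fderiv ℂ f z) (z + (0 : ℂ) • v) := by
      simpa using (hf z).hasFDerivAt
    exact h3.comp_hasDerivAt (0 : ℂ) h2
  rw [← h1.deriv]
  have hd : Differentiable ℂ (fun s : ℂ => f (z + s • v)) := by fun_prop
  exact Complex.norm_deriv_le_of_forall_mem_sphere_norm_le hR hd.diffContOnCl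
    fun s hs => h s (by simpa using hs)

theorem Differentiable.norm_fderiv_le {E : Type*} [NormedAddCommGroup E] [NormedSpace ℂ E]
    {f : E → ℂ} (hf : Differentiable ℂ f) {z : E} {R M : ℝ} (hR : 0 < R)
    (h : ∀ w, ‖w - z‖ ≤ R → ‖f w‖ ≤ M) : ‖fderiv ℂ f z‖ ≤ M / R := by
  have hM : 0 ≤ M := (norm_nonneg _).trans (h z (by simpa using hR.le))
  refine ContinuousLinearMap.opNorm_le_bound _ (by positivity) fun v => ?_
  rcases eq_or_ne v 0 with rfl | hv
  · simp
  · have hv' : 0 < ‖v‖ := norm_pos_iff.2 hv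
    refine (hf.norm_fderiv_apply_le (v := v) (div_pos hR hv') (M := M) fun s hs => h _ ?_).trans
      (le_of_eq ?_)
    · rw [add_sub_cancel_left, norm_smul, hs, div_mul_cancel₀ _ hv'.ne']
    · field_simp

-- Cauchy's estimate on unit balls turns a summable bound for the terms on a larger ball into one
-- for their derivatives, so the series may be differentiated termwise.
open Metric Set Filter Topology in
theorem differentiable_tsum_of_locally_bounded {ι E : Type*} [NormedAddCommGroup E]
    [NormedSpace ℂ E] {f : ι → E → ℂ} (hf : ∀ i, Differentiable ℂ (f i))
    (h : ∀ R : ℝ, ∃ u : ι → ℝ, Summable u ∧ ∀ i z, ‖z‖ ≤ R → ‖f i z‖ ≤ u i) :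
    Differentiable ℂ fun z => ∑' i, f i z := by
  intro z
  obtain ⟨u, hu, hb⟩ := h (‖z‖ + 2)
  have hb' : ∀ i w, ‖w - z‖ ≤ 2 → ‖f i w‖ ≤ u i := fun i w hw => hb i w (by
    calc ‖w‖ = ‖z + (w - z)‖ := by congr 1; abel
      _ ≤ ‖z‖ + ‖w - z‖ := norm_add_le _ _
      _ ≤ _ := by linarith)
  let _ : NormedSpace ℝ E := NormedSpace.restrictScalars ℝ ℂ _
  refine (hasFDerivAt_tsum_of_isPreconnected (f' := fun i w => fderiv ℂ (f i) w) hu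
    (isOpen_ball (x := z) (ε := 1)) (convex_ball z 1).isPreconnected
    (fun i w _ => (hf i w).hasFDerivAt) (fun i w hw => ?_) (mem_ball_self one_pos)
    (hu.of_norm_bounded fun i => hb' i z (by simp)) (mem_ball_self one_pos)).differentiableAt
  have := (hf i).norm_fderiv_le (z := w) one_pos (M := u i) fun x hx => hb' i x (by
    rw [mem_ball_iff_norm] at hw
    calc ‖x - z‖ = ‖(x - w) + (w - z)‖ := by congr 1; abel
      _ ≤ ‖x - w‖ + ‖w - z‖ := norm_add_le _ _
      _ ≤ 2 := by linarith)
  simpa using this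

-- The directional derivative is a Cauchy integral over the circle `z + e^{iθ} v`, and this integral
-- can be differentiated in `z` under the integral sign.
open Metric Set Filter Topology MeasureTheory in
theorem Differentiable.fderiv_apply_differentiable {n : ℕ} {f : Cn n → ℂ}
    (hf : Differentiable ℂ f) (v : Cn n) : Differentiable ℂ fun z => fderiv ℂ f z v := by
  have key : ∀ z, fderiv ℂ f z v = (2 * Real.pi * Complex.I : ℂ)⁻¹ *
      ∫ θ in (0 : ℝ)..2 * Real.pi, _root_.deriv (circleMap 0 1) θ *
        ((1 / (circleMap 0 1 θ) ^ 2) * f (z + circleMap 0 1 θ • v)) := by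
    intro z
    have h1 : HasDerivAt (fun s : ℂ => f (z + s • v)) (fderiv ℂ f z v) 0 := by
      have h2 : HasDerivAt (fun s : ℂ => z + s • v) v 0 := by
        simpa using ((hasDerivAt_id (0 : ℂ)).smul_const v).const_add z
      have h3 : HasFDerivAt f (fderiv ℂ f z) (z + (0 : ℂ) • v) := by
        simpa using (hf z).hasFDerivAt
      exact h3.comp_hasDerivAt (0 : ℂ) h2
    have hd : Differentiable ℂ (fun s : ℂ => f (z + s • v)) := by fun_prop
    have := (hd.differentiableOn (s := closedBall 0 1)).deriv_eq_smul_circleIntegral one_pos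
    rw [h1.deriv] at this
    have h0 : (2 * Real.pi * Complex.I : ℂ) ≠ 0 := by
      simp [Real.pi_ne_zero, Complex.I_ne_zero]
    rw [eq_inv_mul_iff_mul_eq₀ h0, ← smul_eq_mul, ← this, circleIntegral]
    simp only [smul_eq_mul, sub_zero]
  rw [funext key]
  refine Differentiable.const_mul ?_ _
  intro z
  -- Radius `‖v‖ + 2`: distance 1 for the moving point, `‖v‖` for the circle, and 1 for the Cauchy
  -- estimate of the derivative.
  obtain ⟨M, hM⟩ := (isCompact_closedBall z (‖v‖ + 2)).exists_bound_of_continuousOn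
    hf.continuous.continuousOn
  let F' : Cn n → ℝ → Cn n →L[ℂ] ℂ := fun w θ => (_root_.deriv (circleMap 0 1) θ *
    (1 / (circleMap 0 1 θ) ^ 2)) • fderiv ℂ f (w + circleMap 0 1 θ • v)
  have hc : Continuous fun θ : ℝ => _root_.deriv (circleMap 0 1) θ * (1 / (circleMap 0 1 θ) ^ 2) := by
    simp only [deriv_circleMap]
    refine Continuous.mul (by fun_prop) (Continuous.div continuous_const (by fun_prop) fun θ => ?_)
    exact pow_ne_zero _ (circleMap_ne_center one_ne_zero)
  have hn : ∀ θ : ℝ, ‖_root_.deriv (circleMap 0 1) θ * (1 / (circleMap 0 1 θ) ^ 2)‖ = 1 := by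
    intro θ; simp [deriv_circleMap]
  have hcont : ∀ w : Cn n, Continuous fun θ : ℝ => _root_.deriv (circleMap 0 1) θ *
        ((1 / (circleMap 0 1 θ) ^ 2) * f (w + circleMap 0 1 θ • v)) := by
    intro w
    simp only [← mul_assoc]
    exact hc.mul (hf.continuous.comp (by fun_prop))
  refine (intervalIntegral.hasFDerivAt_integral_of_dominated_of_fderiv_le (F' := F')
    (bound := fun _ => M) (ball_mem_nhds z one_pos)
    (Eventually.of_forall fun w => (hcont w).aestronglyMeasurable)
    ((hcont z).intervalIntegrable _ _) ?_ (Eventually.of_forall fun θ _ w hw => ?_)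
    (continuous_const.intervalIntegrable _ _)
    (Eventually.of_forall fun θ _ w hw => ?_)).differentiableAt
  · refine (hc.aestronglyMeasurable).smul ?_
    exact ((measurable_fderiv ℂ f).comp
      (by fun_prop : Continuous fun θ : ℝ => z + circleMap 0 1 θ • v).measurable).aestronglyMeasurable
  · simp only [F', norm_smul, hn, one_mul]
    have := hf.norm_fderiv_le (z := w + circleMap 0 1 θ • v) one_pos (M := M) fun x hx => hM x (by
      rw [mem_ball_iff_norm] at hw
      rw [mem_closedBall_iff_norm]
      calc ‖x - z‖ = ‖(x - (w + circleMap 0 1 θ • v)) + (w - z) + circleMap 0 1 θ • v‖ := by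
            congr 1; abel
        _ ≤ ‖x - (w + circleMap 0 1 θ • v)‖ + ‖w - z‖ + ‖circleMap 0 1 θ • v‖ := norm_add₃_le
        _ ≤ 1 + 1 + ‖v‖ := by
            have : ‖circleMap 0 1 θ • v‖ = ‖v‖ := by simp [norm_smul]
            rw [this]; gcongr
        _ = _ := by ring)
    simpa using this
  · simp only [← mul_assoc]
    have h4 : HasFDerivAt (fun w : Cn n => f (w + circleMap 0 1 θ • v))
        (fderiv ℂ f (w + circleMap 0 1 θ • v)) w := by
      have := (hf (w + circleMap 0 1 θ • v)).hasFDerivAt.comp w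
        ((hasFDerivAt_id w).add_const (circleMap 0 1 θ • v))
      rwa [ContinuousLinearMap.comp_id] at this
    exact h4.const_mul _

/-! ### Iterated partial derivatives: commutation, Cauchy bounds, identity theorem. -/

section PartialDerivatives

variable {n : ℕ}

theorem partialD_differentiable {f : Cn n → ℂ} (hf : Differentiable ℂ f) (j : Fin n) :
    Differentiable ℂ (partialD j f) :=
  hf.fderiv_apply_differentiable _

theorem fderiv_apply_eq_sum (f : Cn n → ℂ) (z v : Cn n) :
    fderiv ℂ f z v = ∑ j, v j * partialD j f z := by
  have hv : v = ∑ j, v j • EuclideanSpace.single j (1 : ℂ) := by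
    ext i
    simp [Pi.single_apply]
  conv_lhs => rw [hv]
  simp [map_sum, partialD]

theorem fderiv_differentiable {f : Cn n → ℂ} (hf : Differentiable ℂ f) :
    Differentiable ℂ (fderiv ℂ f) := by
  have : fderiv ℂ f = fun z => ∑ j, partialD j f z •
      (EuclideanSpace.proj j : Cn n →L[ℂ] ℂ) := by
    ext z v
    rw [fderiv_apply_eq_sum]
    simp [mul_comm]
  rw [this]
  have := fun j => partialD_differentiable hf j
  fun_prop

theorem partialD_comm {f : Cn n → ℂ} (hf : Differentiable ℂ f) (i j : Fin n) :
    partialD i (partialD j f) = partialD j (partialD i f) := by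
  have h (a b : Fin n) (z : Cn n) : partialD a (partialD b f) z =
      fderiv ℂ (fderiv ℂ f) z (EuclideanSpace.single a 1) (EuclideanSpace.single b 1) := by
    have h1 := ((fderiv_differentiable hf z).hasFDerivAt).clm_apply
      (hasFDerivAt_const (EuclideanSpace.single b (1 : ℂ)) z)
    change fderiv ℂ (fun z => fderiv ℂ f z (EuclideanSpace.single b 1)) z _ = _
    rw [h1.fderiv]
    simp
  ext z
  rw [h, h]
  exact second_derivative_symmetric (fun y => (hf y).hasFDerivAt)
    (fderiv_differentiable hf z).hasFDerivAt _ _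

theorem partialD_add {f g : Cn n → ℂ} (hf : Differentiable ℂ f) (hg : Differentiable ℂ g)
    (j : Fin n) : partialD j (f + g) = partialD j f + partialD j g := by
  ext z
  simp [partialD, fderiv_add (hf z) (hg z)]

theorem partialD_smul {f : Cn n → ℂ} (hf : Differentiable ℂ f) (c : ℂ)
    (j : Fin n) : partialD j (c • f) = c • partialD j f := by
  ext z
  simp [partialD, fderiv_const_smul (hf z)]

theorem partialD_iterate_differentiable {f : Cn n → ℂ} (hf : Differentiable ℂ f) (j : Fin n)
    (k : ℕ) : Differentiable ℂ ((partialD j)^[k] f) := by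
  induction k with
  | zero => exact hf
  | succ k ih => rw [Function.iterate_succ_apply']; exact partialD_differentiable ih j

theorem partialD_iterate_add {f g : Cn n → ℂ} (hf : Differentiable ℂ f) (hg : Differentiable ℂ g)
    (j : Fin n) (k : ℕ) :
    (partialD j)^[k] (f + g) = (partialD j)^[k] f + (partialD j)^[k] g := by
  induction k with
  | zero => rfl
  | succ k ih =>
    rw [Function.iterate_succ_apply', ih, partialD_add (partialD_iterate_differentiable hf j k)
      (partialD_iterate_differentiable hg j k), Function.iterate_succ_apply',
      Function.iterate_succ_apply']

theorem partialD_iterate_smul {f : Cn n → ℂ} (hf : Differentiable ℂ f) (c : ℂ)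
    (j : Fin n) (k : ℕ) : (partialD j)^[k] (c • f) = c • (partialD j)^[k] f := by
  induction k with
  | zero => rfl
  | succ k ih =>
    rw [Function.iterate_succ_apply', ih, partialD_smul (partialD_iterate_differentiable hf j k),
      Function.iterate_succ_apply']

theorem partialD_iterate_comm {f : Cn n → ℂ} (hf : Differentiable ℂ f) (i j : Fin n) (k : ℕ) :
    partialD i ((partialD j)^[k] f) = (partialD j)^[k] (partialD i f) := by
  induction k with
  | zero => rfl
  | succ k ih =>
    rw [Function.iterate_succ_apply', partialD_comm (partialD_iterate_differentiable hf j k), ih,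
      Function.iterate_succ_apply']

/-- The iterated derivative along a list of coordinates. -/
def listD (l : List (Fin n)) (α : MIdx n) (f : Cn n → ℂ) : Cn n → ℂ :=
  l.foldr (fun j g => (partialD j)^[α j] g) f

theorem listD_cons (j : Fin n) (l : List (Fin n)) (α : MIdx n) (f : Cn n → ℂ) :
    listD (j :: l) α f = (partialD j)^[α j] (listD l α f) := rfl

theorem listD_differentiable (l : List (Fin n)) (α : MIdx n) {f : Cn n → ℂ}
    (hf : Differentiable ℂ f) : Differentiable ℂ (listD l α f) := by
  induction l with
  | nil => exact hf
  | cons j l ih => exact partialD_iterate_differentiable ih j _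

theorem listD_add (l : List (Fin n)) (α : MIdx n) {f g : Cn n → ℂ}
    (hf : Differentiable ℂ f) (hg : Differentiable ℂ g) :
    listD l α (f + g) = listD l α f + listD l α g := by
  induction l with
  | nil => rfl
  | cons j l ih =>
    rw [listD_cons, ih, partialD_iterate_add (listD_differentiable l α hf)
      (listD_differentiable l α hg)]
    rfl

theorem listD_smul (l : List (Fin n)) (α : MIdx n) {f : Cn n → ℂ}
    (hf : Differentiable ℂ f) (c : ℂ) : listD l α (c • f) = c • listD l α f := by
  induction l with
  | nil => rfl
  | cons j l ih =>
    rw [listD_cons, ih, partialD_iterate_smul (listD_differentiable l α hf)]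
    rfl

theorem partialD_listD (l : List (Fin n)) (α : MIdx n) {f : Cn n → ℂ}
    (hf : Differentiable ℂ f) (i : Fin n) :
    partialD i (listD l α f) = listD l α (partialD i f) := by
  induction l with
  | nil => rfl
  | cons j l ih =>
    rw [listD_cons, partialD_iterate_comm (listD_differentiable l α hf), ih, listD_cons]

theorem listD_congr {l : List (Fin n)} {α β : MIdx n} (h : ∀ j ∈ l, α j = β j) (f : Cn n → ℂ) :
    listD l α f = listD l β f := by
  induction l with
  | nil => rfl
  | cons j l ih =>
    rw [listD_cons, listD_cons, ih fun i hi => h i (List.mem_cons_of_mem _ hi),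
      h j List.mem_cons_self]

/-- In a list without repetitions exactly one coordinate absorbs the extra derivative; commutation
of partial derivatives carries it there. -/
theorem listD_partialD {l : List (Fin n)} (hl : l.Nodup) (α : MIdx n) {f : Cn n → ℂ}
    (hf : Differentiable ℂ f) {i : Fin n} (hi : i ∈ l) :
    listD l α (partialD i f) = listD l (α + Pi.single i 1) f := by
  induction l with
  | nil => simp at hi
  | cons j l ih =>
    rw [List.nodup_cons] at hl
    rw [listD_cons, listD_cons]
    by_cases hij : i = j
    · subst hij
      rw [← partialD_listD l α hf, ← Function.iterate_succ_apply]
      have h : listD l (α + Pi.single i 1) f = listD l α f := listD_congr (fun k hk => by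
        have : k ≠ i := fun h => hl.1 (h ▸ hk)
        simp [this]) f
      rw [h]
      simp
    · rw [ih hl.2 ((List.mem_cons.1 hi).resolve_left hij)]
      simp [Ne.symm hij]

theorem iterD_eq_listD (α : MIdx n) (f : Cn n → ℂ) : iterD α f = listD (List.finRange n) α f := rfl

theorem iterD_differentiable (α : MIdx n) {f : Cn n → ℂ} (hf : Differentiable ℂ f) :
    Differentiable ℂ (iterD α f) := listD_differentiable _ α hf

theorem iterD_add (α : MIdx n) {f g : Cn n → ℂ} (hf : Differentiable ℂ f)
    (hg : Differentiable ℂ g) : iterD α (f + g) = iterD α f + iterD α g := listD_add _ α hf hg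

theorem iterD_smul (α : MIdx n) {f : Cn n → ℂ} (hf : Differentiable ℂ f) (c : ℂ) :
    iterD α (c • f) = c • iterD α f := listD_smul _ α hf c

theorem iterD_partialD (α : MIdx n) {f : Cn n → ℂ} (hf : Differentiable ℂ f) (i : Fin n) :
    iterD α (partialD i f) = iterD (α + Pi.single i 1) f :=
  listD_partialD (List.nodup_finRange n) α hf (List.mem_finRange i)

theorem iterD_zero (f : Cn n → ℂ) : iterD 0 f = f := by
  rw [iterD_eq_listD]
  induction List.finRange n with
  | nil => rfl
  | cons j l ih => rw [listD_cons, ih]; rfl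

theorem hasDerivAt_line {f : Cn n → ℂ} (hf : Differentiable ℂ f) (z v : Cn n) (s : ℂ) :
    HasDerivAt (fun t : ℂ => f (z + t • v)) (∑ j, v j * partialD j f (z + s • v)) s := by
  rw [← fderiv_apply_eq_sum]
  have h2 : HasDerivAt (fun s : ℂ => z + s • v) v s := by
    simpa using ((hasDerivAt_id s).smul_const v).const_add z
  exact (hf _).hasFDerivAt.comp_hasDerivAt s h2

theorem partialD_iterate_line {f : Cn n → ℂ} (hf : Differentiable ℂ f) (j : Fin n) (k : ℕ)
    (z : Cn n) : iteratedDeriv k (fun s : ℂ => f (z + s • EuclideanSpace.single j 1)) =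
      fun s => (partialD j)^[k] f (z + s • EuclideanSpace.single j 1) := by
  induction k with
  | zero => rfl
  | succ k ih =>
    ext s
    rw [iteratedDeriv_succ, ih,
      (hasDerivAt_line (partialD_iterate_differentiable hf j k) z _ s).deriv,
      Function.iterate_succ_apply']
    simp

theorem norm_partialD_iterate_le {f : Cn n → ℂ} (hf : Differentiable ℂ f) (j : Fin n) (k : ℕ)
    {z : Cn n} {r M : ℝ} (hr : 0 < r) (h : ∀ w, ‖w - z‖ ≤ r → ‖f w‖ ≤ M) :
    ‖(partialD j)^[k] f z‖ ≤ k.factorial / r ^ k * M := by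
  have h1 := congrFun (partialD_iterate_line hf j k z) 0
  simp only [zero_smul, add_zero] at h1
  rw [← h1, div_mul_eq_mul_div]
  have hd : Differentiable ℂ (fun s : ℂ => f (z + s • EuclideanSpace.single j 1)) := by fun_prop
  refine Complex.norm_iteratedDeriv_le_of_forall_mem_sphere_norm_le k hr hd.diffContOnCl
    fun s hs => h _ ?_
  simp only [mem_sphere_iff_norm, sub_zero] at hs
  simp [norm_smul, hs]

/-- One-variable Cauchy estimates are used coordinate by coordinate. Each moves the point by at most
`r`, hence the total radius `l.length * r`. -/
theorem norm_listD_le (l : List (Fin n)) (α : MIdx n) {f : Cn n → ℂ} (hf : Differentiable ℂ f)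
    {r M : ℝ} (hr : 0 < r) (z : Cn n) (h : ∀ w, ‖w - z‖ ≤ l.length * r → ‖f w‖ ≤ M) :
    ‖listD l α f z‖ ≤ (l.map fun j => ((α j).factorial : ℝ) / r ^ α j).prod * M := by
  induction l generalizing z with
  | nil => simpa [listD] using h z (by simp)
  | cons j l ih =>
    rw [listD_cons, List.map_cons, List.prod_cons, mul_assoc]
    refine norm_partialD_iterate_le (listD_differentiable l α hf) j _ hr fun w hw =>
      ih w fun x hx => h x ?_
    calc ‖x - z‖ = ‖(x - w) + (w - z)‖ := by congr 1; abel
      _ ≤ ‖x - w‖ + ‖w - z‖ := norm_add_le _ _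
      _ ≤ l.length * r + r := add_le_add hx hw
      _ = _ := by push_cast [List.length_cons]; ring

theorem norm_iterD_le (α : MIdx n) {f : Cn n → ℂ} (hf : Differentiable ℂ f)
    {r M : ℝ} (hr : 0 < r) (z : Cn n) (h : ∀ w, ‖w - z‖ ≤ n * r → ‖f w‖ ≤ M) :
    ‖iterD α f z‖ ≤ α.fact / r ^ α.len * M := by
  have := norm_listD_le (List.finRange n) α hf hr z (M := M) (by simpa using h)
  rw [iterD_eq_listD]
  refine this.trans (le_of_eq ?_)
  congr 1
  rw [← List.ofFn_eq_map, List.prod_ofFn, Finset.prod_div_distrib, Finset.prod_pow_eq_pow_sum]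
  simp [MIdx.fact, MIdx.len]

/-- The derivative along the line is a combination of the `partialD j f` with constant coefficients,
and each of these again has all derivatives zero at `z`; so the induction runs over all `f` at once.
-/
theorem iteratedDeriv_line_eq_zero {z : Cn n} (k : ℕ) {f : Cn n → ℂ} (hf : Differentiable ℂ f)
    (h : ∀ α, iterD α f z = 0) (v : Cn n) :
    iteratedDeriv k (fun t : ℂ => f (z + t • v)) 0 = 0 := by
  induction k generalizing f with
  | zero => simpa [iterD_zero] using h 0
  | succ k ih =>
    rw [iteratedDeriv_succ', funext fun s => (hasDerivAt_line hf z v s).deriv]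
    have hd (j : Fin n) : Differentiable ℂ fun t : ℂ => partialD j f (z + t • v) := by
      have := partialD_differentiable hf j
      fun_prop
    rw [iteratedDeriv_fun_sum fun j _ => ((hd j).const_mul _).contDiff.contDiffAt]
    refine Finset.sum_eq_zero fun j _ => ?_
    rw [iteratedDeriv_const_mul_field, ih (partialD_differentiable hf j) fun α => by
      rw [iterD_partialD α hf, h], mul_zero]

theorem eq_zero_of_iterD_eq_zero {z : Cn n} {f : Cn n → ℂ} (hf : Differentiable ℂ f)
    (h : ∀ α, iterD α f z = 0) : f = 0 := by
  ext w
  have hd : Differentiable ℂ fun t : ℂ => f (z + t • (w - z)) := by fun_prop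
  have := Complex.taylorSeries_eq_of_entire' 0 1 hd
  simp only [iteratedDeriv_line_eq_zero _ hf h] at this
  simpa using this.symm

theorem eq_of_iterD_eq {z : Cn n} {f g : Cn n → ℂ} (hf : Differentiable ℂ f)
    (hg : Differentiable ℂ g) (h : ∀ α, iterD α f z = iterD α g z) : f = g := by
  have hg' : Differentiable ℂ ((-1 : ℂ) • g) := hg.const_smul _
  have := eq_zero_of_iterD_eq_zero (z := z) (hf.add hg') fun α => by
    rw [iterD_add α hf hg', iterD_smul α hg, Pi.add_apply, Pi.smul_apply, h]; simp
  ext w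
  have h2 := congrFun this w
  simp only [Pi.add_apply, Pi.smul_apply, smul_eq_mul, Pi.zero_apply, neg_mul, one_mul] at h2
  linear_combination h2

end PartialDerivatives


/-! ### Derivatives and binomial expansion of `(w - z)^α`. -/

section ShiftedMonomials

variable {n : ℕ}

/-- The shifted monomial `w ↦ (w - z)^α`. -/
def shiftPow (z : Cn n) (α : MIdx n) : Cn n → ℂ := fun w => zpowIdx (w - z) α

theorem shiftPow_differentiable (z : Cn n) (α : MIdx n) : Differentiable ℂ (shiftPow z α) := by
  unfold shiftPow zpowIdx
  fun_prop

theorem partialD_shiftPow (z : Cn n) (α : MIdx n) (j : Fin n) :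
    partialD j (shiftPow z α) = (α j : ℂ) • shiftPow z (α - Pi.single j 1) := by
  ext w
  have h1 := hasDerivAt_line (shiftPow_differentiable z α) w (EuclideanSpace.single j 1) 0
  have h2 : ∀ s : ℂ, shiftPow z α (w + s • EuclideanSpace.single j 1) =
      (s + (w j - z j)) ^ α j * ∏ i ∈ Finset.univ.erase j, (w i - z i) ^ α i := by
    intro s
    rw [shiftPow, zpowIdx, ← Finset.mul_prod_erase _ _ (Finset.mem_univ j)]
    congr 1
    · simp only [PiLp.sub_apply, PiLp.add_apply, PiLp.smul_apply, PiLp.single_apply]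
      simp only [if_true, smul_eq_mul, mul_one]
      ring
    · refine Finset.prod_congr rfl fun i hi => ?_
      have : i ≠ j := Finset.ne_of_mem_erase hi
      simp [this]
  have h3 : HasDerivAt (fun s : ℂ => shiftPow z α (w + s • EuclideanSpace.single j 1))
      (α j * (w j - z j) ^ (α j - 1) * ∏ i ∈ Finset.univ.erase j, (w i - z i) ^ α i) 0 := by
    rw [funext h2]
    have h4 := (((hasDerivAt_id (0 : ℂ)).add_const (w j - z j)).pow (α j)).mul_const
      (∏ i ∈ Finset.univ.erase j, (w i - z i) ^ α i)
    simpa using h4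
  have h5 := h1.unique h3
  simp only [PiLp.single_apply, ite_mul, one_mul, zero_mul, Finset.sum_ite_eq', Finset.mem_univ,
    if_true, zero_smul, add_zero] at h5
  rw [h5, Pi.smul_apply, shiftPow, zpowIdx, ← Finset.mul_prod_erase _ _ (Finset.mem_univ j),
    smul_eq_mul, mul_assoc]
  congr 2
  · simp
  · refine Finset.prod_congr rfl fun i hi => ?_
    have : i ≠ j := Finset.ne_of_mem_erase hi
    simp [this]

theorem partialD_iterate_shiftPow (z : Cn n) (α : MIdx n) (j : Fin n) (k : ℕ) :
    (partialD j)^[k] (shiftPow z α) =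
      ((α j).descFactorial k : ℂ) • shiftPow z (α - Pi.single j k) := by
  induction k with
  | zero => simp
  | succ k ih =>
    rw [Function.iterate_succ_apply', ih, partialD_smul (shiftPow_differentiable _ _),
      partialD_shiftPow, smul_smul, Nat.descFactorial_succ, tsub_tsub, ← Pi.single_add]
    congr 1
    simp [mul_comm]

theorem listD_shiftPow {l : List (Fin n)} (hl : l.Nodup) (z : Cn n) (α β : MIdx n) :
    listD l β (shiftPow z α) = ((l.map fun j => ((α j).descFactorial (β j) : ℂ)).prod) •
      shiftPow z (fun i => if i ∈ l then α i - β i else α i) := by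
  induction l with
  | nil => simp [listD]
  | cons j l ih =>
    rw [List.nodup_cons] at hl
    rw [listD_cons, ih hl.2, partialD_iterate_smul (shiftPow_differentiable _ _),
      partialD_iterate_shiftPow, smul_smul, List.map_cons, List.prod_cons, mul_comm]
    simp only [hl.1, if_false]
    congr 2
    ext i
    rcases eq_or_ne i j with rfl | hij
    · simp [hl.1]
    · simp [hij]

theorem iterD_shiftPow_self (z : Cn n) (α β : MIdx n) :
    iterD β (shiftPow z α) z = if β = α then (α.fact : ℂ) else 0 := by
  rw [iterD_eq_listD, listD_shiftPow (List.nodup_finRange n), Pi.smul_apply, smul_eq_mul, shiftPow,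
    zpowIdx, ← List.ofFn_eq_map, List.prod_ofFn, ← Finset.prod_mul_distrib]
  simp only [List.mem_finRange, if_true, sub_self, PiLp.zero_apply]
  split_ifs with h
  · subst h
    simp [MIdx.fact, Nat.descFactorial_self]
  · obtain ⟨j, hj⟩ := Function.ne_iff.1 h
    refine Finset.prod_eq_zero (Finset.mem_univ j) ?_
    -- Too few derivatives in coordinate `j` leave a positive power of zero; too many make the
    -- falling factorial vanish.
    rcases lt_or_gt_of_ne hj with h1 | h1
    · rw [zero_pow (by omega), mul_zero]
    · rw [Nat.descFactorial_eq_zero_iff_lt.2 h1]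
      simp

theorem norm_zpowIdx_le (z : Cn n) (α : MIdx n) : ‖zpowIdx z α‖ ≤ ‖z‖ ^ α.len := by
  rw [zpowIdx, norm_prod, MIdx.len, ← Finset.prod_pow_eq_pow_sum]
  refine Finset.prod_le_prod (fun _ _ => norm_nonneg _) fun j _ => ?_
  rw [norm_pow]
  exact pow_le_pow_left₀ (norm_nonneg _) (PiLp.norm_apply_le z j) _

theorem MIdx.mem_Iic_iff {α β : MIdx n} : β ∈ Finset.Iic α ↔ β ∈ Fintype.piFinset fun j =>
    Finset.range (α j + 1) := by
  simp [Pi.le_def]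

theorem zpowIdx_add (x y : Cn n) (α : MIdx n) :
    zpowIdx (x + y) α = ∑ β ∈ Finset.Iic α,
      (α.fact / (MIdx.fact (α - β) * MIdx.fact β) : ℂ) * (zpowIdx y (α - β) * zpowIdx x β) := by
  have h1 : (Finset.Iic α) = Fintype.piFinset fun j => Finset.range (α j + 1) := by
    ext β; exact MIdx.mem_Iic_iff
  simp only [zpowIdx, PiLp.add_apply, add_pow]
  rw [Finset.prod_univ_sum, h1]
  refine Finset.sum_congr rfl fun β hβ => ?_
  rw [← Finset.prod_mul_distrib]
  simp only [MIdx.fact]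
  push_cast
  rw [← Finset.prod_mul_distrib, ← Finset.prod_div_distrib, ← Finset.prod_mul_distrib]
  refine Finset.prod_congr rfl fun j _ => ?_
  have hj : β j ≤ α j := by
    have := Fintype.mem_piFinset.1 hβ j
    rw [Finset.mem_range] at this
    omega
  rw [Nat.cast_choose ℂ hj, Pi.sub_apply]
  ring

end ShiftedMonomials

/-! ### Weighted bounds for monomials and derivatives. -/

section Estimates

/-- The weight `k^(k/p)`. -/
def powWeight (p : ℝ) (k : ℕ) : ℝ := (k : ℝ) ^ ((k : ℝ) / p)

theorem powWeight_pos (p : ℝ) (k : ℕ) : 0 < powWeight p k := by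
  rcases Nat.eq_zero_or_pos k with rfl | hk
  · simp [powWeight]
  · exact Real.rpow_pos_of_pos (by exact_mod_cast hk) _

theorem powWeight_eq {p : ℝ} (k : ℕ) : powWeight p k = ((k : ℝ) ^ (1 / p)) ^ k := by
  rw [powWeight, ← Real.rpow_natCast, ← Real.rpow_mul (Nat.cast_nonneg k)]
  congr 1
  ring

theorem powWeight_eq' {p : ℝ} (k : ℕ) : powWeight p k = ((k : ℝ) ^ k) ^ (1 / p) := by
  rw [powWeight, ← Real.rpow_natCast, ← Real.rpow_mul (Nat.cast_nonneg k)]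
  congr 1
  ring

/-- A form of the maximum of `x^k exp(-t x^p)`: take `u ≤ exp u` at `u = p t x^p / k` and raise to
the power `k/p`. The base `(1/(pt))^(1/p)` tends to 0 as `t` grows, which is where arbitrarily small
`ε` come from. -/
theorem pow_le_mul_exp_rpow {p t x : ℝ} (hp : 0 < p) (ht : 0 < t) (hx : 0 ≤ x) (k : ℕ) :
    x ^ k ≤ ((1 / (p * t)) ^ (1 / p)) ^ k * powWeight p k * Real.exp (t * x ^ p) := by
  rcases Nat.eq_zero_or_pos k with rfl | hk
  · simp only [pow_zero, one_mul, powWeight, Nat.cast_zero, zero_div, Real.rpow_zero]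
    exact Real.one_le_exp (mul_nonneg ht.le (Real.rpow_nonneg hx p))
  have hk' : (0 : ℝ) < k := by exact_mod_cast hk
  have h1 : x ^ p ≤ 1 / (p * t) * k * Real.exp (p * t * x ^ p / k) := by
    have : p * t * x ^ p / k ≤ Real.exp (p * t * x ^ p / k) :=
      (lt_add_one _).le.trans (Real.add_one_le_exp _)
    calc x ^ p = 1 / (p * t) * k * (p * t * x ^ p / k) := by field_simp
      _ ≤ _ := by gcongr
  have h2 : x = (x ^ p) ^ (1 / p) := by
    rw [← Real.rpow_mul hx, mul_one_div_cancel hp.ne', Real.rpow_one]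
  have h3 : x ≤ (1 / (p * t)) ^ (1 / p) * (k : ℝ) ^ (1 / p) * Real.exp (t * x ^ p / k) := by
    calc x = (x ^ p) ^ (1 / p) := h2
      _ ≤ (1 / (p * t) * k * Real.exp (p * t * x ^ p / k)) ^ (1 / p) :=
          Real.rpow_le_rpow (Real.rpow_nonneg hx p) h1 (by positivity)
      _ = _ := by
          rw [Real.mul_rpow (by positivity) (by positivity),
            Real.mul_rpow (by positivity) (by positivity), ← Real.exp_mul]
          congr 2
          field_simp
  calc x ^ k ≤ ((1 / (p * t)) ^ (1 / p) * (k : ℝ) ^ (1 / p) * Real.exp (t * x ^ p / k)) ^ k :=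
        pow_le_pow_left₀ hx h3 k
    _ = _ := by
        rw [mul_pow, mul_pow, powWeight_eq, ← Real.exp_nat_mul]
        congr 2
        field_simp

theorem rpow_add_le_two_rpow_mul {p a b : ℝ} (hp : 0 ≤ p) (ha : 0 ≤ a) (hb : 0 ≤ b) :
    (a + b) ^ p ≤ 2 ^ p * (a ^ p + b ^ p) := by
  have h : a + b ≤ 2 * max a b := by linarith [le_max_left a b, le_max_right a b]
  calc (a + b) ^ p ≤ (2 * max a b) ^ p := Real.rpow_le_rpow (by positivity) h hp
    _ = 2 ^ p * (max a b) ^ p := Real.mul_rpow (by norm_num) (le_max_of_le_left ha)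
    _ ≤ _ := by
      gcongr
      rcases max_choice a b with h | h <;> rw [h]
      · linarith [Real.rpow_nonneg hb p]
      · linarith [Real.rpow_nonneg ha p]

variable {n : ℕ} {p : ℝ}

theorem norm_shiftPow_le (hp : 0 < p) {δ : ℝ} (hδ : 0 < δ) : ∃ t₀ > 0, ∀ t ≥ t₀,
    ∀ (z : Cn n) (α : MIdx n) (w : Cn n), ‖shiftPow z α w‖ ≤
      2 * δ ^ α.len * powWeight p α.len * Real.exp (t * ‖z‖ ^ p) * Real.exp (t * ‖w‖ ^ p) := by
  refine ⟨1 / (p * (δ / 2) ^ p), by positivity, fun t ht z α w => ?_⟩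
  -- With this `s` the base in `pow_le_mul_exp_rpow` is `δ/2`; the spare `1/2` absorbs the `2^|α|`
  -- lost in separating `w` from `z`.
  set s := 1 / (p * (δ / 2) ^ p) with hs
  have hs0 : 0 < s := by positivity
  have hD : (1 / (p * s)) ^ (1 / p) = δ / 2 := by
    have : 1 / (p * s) = (δ / 2) ^ p := by rw [hs]; field_simp
    rw [this, ← Real.rpow_mul (by positivity), mul_one_div_cancel hp.ne', Real.rpow_one]
  have hw := pow_le_mul_exp_rpow hp hs0 (norm_nonneg w) α.len
  have hz := pow_le_mul_exp_rpow hp hs0 (norm_nonneg z) α.len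
  rw [hD] at hw hz
  have hW := powWeight_pos p α.len
  have mono : ∀ u : Cn n, Real.exp (s * ‖u‖ ^ p) ≤ Real.exp (t * ‖u‖ ^ p) := fun u => by
    have := Real.rpow_nonneg (norm_nonneg u) p
    gcongr
  have one_le : ∀ u : Cn n, 1 ≤ Real.exp (t * ‖u‖ ^ p) := fun u =>
    Real.one_le_exp (mul_nonneg (hs0.le.trans ht) (Real.rpow_nonneg (norm_nonneg u) p))
  have h1 : ‖w - z‖ ^ α.len ≤ 2 ^ α.len * (‖w‖ ^ α.len + ‖z‖ ^ α.len) := by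
    have := rpow_add_le_two_rpow_mul (Nat.cast_nonneg α.len) (norm_nonneg w) (norm_nonneg z)
    simp only [Real.rpow_natCast] at this
    exact (pow_le_pow_left₀ (norm_nonneg _) (norm_sub_le w z) _).trans this
  have h2 : Real.exp (s * ‖w‖ ^ p) + Real.exp (s * ‖z‖ ^ p) ≤
      2 * (Real.exp (t * ‖z‖ ^ p) * Real.exp (t * ‖w‖ ^ p)) := by
    nlinarith [mono w, mono z, one_le w, one_le z]
  calc ‖shiftPow z α w‖ ≤ ‖w - z‖ ^ α.len := norm_zpowIdx_le _ _
    _ ≤ 2 ^ α.len * (‖w‖ ^ α.len + ‖z‖ ^ α.len) := h1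
    _ ≤ 2 ^ α.len * ((δ / 2) ^ α.len * powWeight p α.len *
        (Real.exp (s * ‖w‖ ^ p) + Real.exp (s * ‖z‖ ^ p))) := by
      gcongr
      linarith
    _ ≤ 2 ^ α.len * ((δ / 2) ^ α.len * powWeight p α.len *
        (2 * (Real.exp (t * ‖z‖ ^ p) * Real.exp (t * ‖w‖ ^ p)))) := by gcongr
    _ = (2 * (δ / 2)) ^ α.len * 2 * powWeight p α.len * Real.exp (t * ‖z‖ ^ p) *
        Real.exp (t * ‖w‖ ^ p) := by rw [mul_pow]; ring
    _ = _ := by rw [mul_div_cancel₀ _ two_ne_zero]; ring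

theorem MIdx.eq_zero_of_len_eq_zero {α : MIdx n} (h : α.len = 0) : α = 0 := by
  ext j
  exact (Finset.sum_eq_zero_iff.1 h) j (Finset.mem_univ j)

/-- The radius `r = |α|^(1/p)` makes `r^|α|` equal to the weight, while `(n r)^p = n^p |α|`, so the
growth of `f` over the enlarged ball costs only a geometric factor `K^|α|`. -/
theorem exists_norm_iterD_le (n : ℕ) (hp : 0 < p) {τ : ℝ} (hτ : 0 ≤ τ) : ∃ K : ℝ, 1 ≤ K ∧
    ∀ (f : Cn n → ℂ) (M : ℝ), Differentiable ℂ f →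
      (∀ w, ‖f w‖ ≤ M * Real.exp (τ * ‖w‖ ^ p)) → ∀ (α : MIdx n) (z : Cn n),
      ‖iterD α f z‖ ≤ M * (α.fact / powWeight p α.len) * K ^ α.len *
        Real.exp (τ * 2 ^ p * ‖z‖ ^ p) := by
  have h2 : (1 : ℝ) ≤ 2 ^ p := Real.one_le_rpow (by norm_num) hp.le
  refine ⟨Real.exp (τ * 2 ^ p * n ^ p), Real.one_le_exp (by positivity),
    fun f M hf hM α z => ?_⟩
  have hM0 : 0 ≤ M := by
    by_contra! h
    have := (norm_nonneg _).trans (hM 0)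
    nlinarith [Real.exp_pos (τ * ‖(0 : Cn n)‖ ^ p)]
  have hz := Real.rpow_nonneg (norm_nonneg z) p
  -- For `|α| = 0` the radius would be zero, so this case is treated directly.
  rcases Nat.eq_zero_or_pos α.len with h0 | hk
  · obtain rfl := MIdx.eq_zero_of_len_eq_zero h0
    rw [iterD_zero, h0]
    simp only [MIdx.fact, Pi.zero_apply, Nat.factorial_zero, Finset.prod_const_one, Nat.cast_one,
      powWeight, Nat.cast_zero, zero_div, Real.rpow_zero, div_one, pow_zero, mul_one]
    refine (hM z).trans ?_
    gcongr
    exact le_mul_of_one_le_right hτ h2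
  have hk' : (0 : ℝ) < α.len := by exact_mod_cast hk
  set r : ℝ := (α.len : ℝ) ^ (1 / p) with hr
  have hr0 : 0 < r := Real.rpow_pos_of_pos hk' _
  have hrp : r ^ p = α.len := by
    rw [hr, ← Real.rpow_mul hk'.le, one_div_mul_cancel hp.ne', Real.rpow_one]
  have := norm_iterD_le α hf hr0 z
    (M := M * (Real.exp (τ * 2 ^ p * n ^ p) ^ α.len * Real.exp (τ * 2 ^ p * ‖z‖ ^ p)))
    fun w hw => (hM w).trans (by
      rw [← Real.exp_nat_mul, ← Real.exp_add]
      gcongr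
      have h3 : ‖w‖ ≤ ‖z‖ + n * r := by
        calc ‖w‖ = ‖z + (w - z)‖ := by congr 1; abel
          _ ≤ ‖z‖ + ‖w - z‖ := norm_add_le _ _
          _ ≤ _ := by linarith
      calc τ * ‖w‖ ^ p ≤ τ * (2 ^ p * (‖z‖ ^ p + (n * r) ^ p)) := by
            gcongr
            exact (Real.rpow_le_rpow (norm_nonneg _) h3 hp.le).trans
              (rpow_add_le_two_rpow_mul hp.le (norm_nonneg _) (by positivity))
        _ = _ := by
            rw [Real.mul_rpow (by positivity) hr0.le, hrp]
            ring)
  refine this.trans (le_of_eq ?_)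
  rw [powWeight_eq, ← hr]
  ring

/-- Over a box of multi-indices the sum factors into `n` partial geometric sums. -/
theorem summable_pow_len (n : ℕ) {ε : ℝ} (h0 : 0 ≤ ε) (h1 : ε < 1) :
    Summable fun α : MIdx n => ε ^ α.len := by
  refine summable_of_sum_le (c := ((1 - ε)⁻¹) ^ n) (fun α => pow_nonneg h0 _) fun s => ?_
  let N := s.sup MIdx.len + 1
  have hs : s ⊆ Fintype.piFinset fun _ : Fin n => Finset.range N := fun α hα => by
    rw [Fintype.mem_piFinset]
    intro j
    rw [Finset.mem_range, Nat.lt_succ_iff]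
    exact (Finset.single_le_sum (fun i _ => Nat.zero_le (α i)) (Finset.mem_univ j)).trans
      (Finset.le_sup (f := MIdx.len) hα)
  calc ∑ α ∈ s, ε ^ α.len
      ≤ ∑ α ∈ Fintype.piFinset fun _ : Fin n => Finset.range N, ε ^ MIdx.len α :=
        Finset.sum_le_sum_of_subset_of_nonneg hs fun α _ _ => pow_nonneg h0 _
    _ = ∏ _j : Fin n, ∑ k ∈ Finset.range N, ε ^ k := by
        rw [Finset.prod_univ_sum]
        exact Finset.sum_congr rfl fun α _ => by
          rw [MIdx.len, Finset.prod_pow_eq_pow_sum]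
    _ ≤ ∏ _j : Fin n, (1 - ε)⁻¹ := by
        refine Finset.prod_le_prod (fun _ _ => Finset.sum_nonneg fun k _ => pow_nonneg h0 k)
          fun _ _ => ?_
        rw [← tsum_geometric_of_lt_one h0 h1]
        exact (summable_geometric_of_lt_one h0 h1).sum_le_tsum _ fun k _ => pow_nonneg h0 k
    _ = _ := by simp

end Estimates

/-! ### Equivalence of the four growth conditions. -/

section Growth

variable {n : ℕ} {p : ℝ}

/-- Pointwise growth of the coefficients relative to a weight. -/
def PointwiseGrowth (p : ℝ) (w : MIdx n → ℝ) (a : MIdx n → Cn n → ℂ) : Prop :=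
  ∀ ε : ℝ, 0 < ε → ∃ B C : ℝ, 0 < B ∧ 0 < C ∧ ∀ (z : Cn n) (α : MIdx n),
    ‖a α z‖ ≤ C * (w α * ε ^ α.len) * Real.exp (B * ‖z‖ ^ p)

theorem weighted_le_iff {τ c : ℝ} {f : Cn n → ℂ} {z : Cn n} :
    weighted p τ f z ≤ c ↔ ‖f z‖ ≤ c * Real.exp (τ * ‖z‖ ^ p) := by
  rw [weighted, Real.exp_neg, ← div_eq_mul_inv, div_le_iff₀ (Real.exp_pos _)]

theorem pointwiseGrowth_iff_ptNorm {w : MIdx n → ℝ} {a : MIdx n → Cn n → ℂ}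
    (ha : ∀ α, Differentiable ℂ (a α)) :
    PointwiseGrowth p w a ↔ ∀ ε : ℝ, 0 < ε → ∃ B C : ℝ, 0 < B ∧ 0 < C ∧ ∀ α : MIdx n,
      a α ∈ submoduleA n p B ∧ ptNorm p B (a α) ≤ C * (w α * ε ^ α.len) := by
  refine forall₂_congr fun ε _ => exists₂_congr fun B C => and_congr_right fun _ =>
    and_congr_right fun _ => ⟨fun h α => ?_, fun h z α => ?_⟩
  · have h' : ∀ z, weighted p B (a α) z ≤ C * (w α * ε ^ α.len) := fun z =>
      weighted_le_iff.2 (h z α)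
    exact ⟨⟨ha α, _, by rintro _ ⟨z, rfl⟩; exact h' z⟩, ciSup_le h'⟩
  · exact weighted_le_iff.1 ((le_ciSup (h α).1.2 z).trans (h α).2)

/-- A geometric factor `c^|α|` between weights is harmless because `ε` is arbitrary: use `ε / c`. -/
theorem PointwiseGrowth.mono {w w' : MIdx n → ℝ} {a : MIdx n → Cn n → ℂ} {c : ℝ} (hc : 0 < c)
    (hw : ∀ α, w α ≤ c ^ α.len * w' α) (h : PointwiseGrowth p w a) : PointwiseGrowth p w' a := by
  intro ε hε
  obtain ⟨B, C, hB, hC, h⟩ := h (ε / c) (by positivity)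
  refine ⟨B, C, hB, hC, fun z α => (h z α).trans ?_⟩
  gcongr C * ?_ * _
  calc w α * (ε / c) ^ α.len ≤ (c ^ α.len * w' α) * (ε / c) ^ α.len := by gcongr; exact hw α
    _ = (c * (ε / c)) ^ α.len * w' α := by rw [mul_pow]; ring
    _ = _ := by rw [mul_div_cancel₀ _ hc.ne']; ring

theorem MIdx.fact_le_factorial_len (α : MIdx n) : α.fact ≤ α.len.factorial :=
  Nat.le_of_dvd (Nat.factorial_pos _) (Nat.prod_factorial_dvd_factorial_sum Finset.univ α)

theorem MIdx.fact_pos (α : MIdx n) : 0 < α.fact :=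
  Finset.prod_pos fun _ _ => Nat.factorial_pos _

/-- The quotient `|α|!/α!` is a multinomial coefficient, one term of the expansion of `(1 + ⋯ +
1)^|α| = n^|α|`. -/
theorem MIdx.factorial_len_le (α : MIdx n) : α.len.factorial ≤ n ^ α.len * α.fact := by
  have h1 := Finset.sum_pow_eq_sum_piAntidiag (Finset.univ : Finset (Fin n)) (fun _ => (1 : ℕ))
    α.len
  have h2 : Nat.multinomial Finset.univ α ≤ n ^ α.len := by
    simp only [Finset.sum_const, Finset.card_univ, Fintype.card_fin, smul_eq_mul, mul_one,
      one_pow, Finset.prod_const_one] at h1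
    rw [h1]
    refine Finset.single_le_sum (f := fun k => Nat.multinomial Finset.univ k)
      (fun _ _ => Nat.zero_le _) ?_
    simp [MIdx.len]
  have h3 := Nat.multinomial_spec Finset.univ α
  calc α.len.factorial = α.fact * Nat.multinomial Finset.univ α := h3.symm
    _ ≤ α.fact * n ^ α.len := Nat.mul_le_mul_left _ h2
    _ = _ := mul_comm _ _

theorem inv_factorial_rpow_le (hp : 0 < p) (α : MIdx n) :
    ((α.len.factorial : ℝ) ^ (1 - 1 / p))⁻¹ ≤ powWeight p α.len / α.fact := by
  have hf : (0 : ℝ) < α.len.factorial := by exact_mod_cast Nat.factorial_pos _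
  have hα : (0 : ℝ) < α.fact := by exact_mod_cast α.fact_pos
  have h1 : (α.fact : ℝ) ≤ α.len.factorial := by exact_mod_cast α.fact_le_factorial_len
  have h2 : (α.len.factorial : ℝ) ≤ (α.len : ℝ) ^ α.len := by
    exact_mod_cast Nat.factorial_le_pow α.len
  rw [Real.rpow_sub hf, Real.rpow_one, inv_div, powWeight_eq']
  gcongr

/-- Combines `k^k ≤ e^k k!` with `|α|! ≤ n^|α| α!`. The base `n + 1` keeps the constant positive
when `n = 0`, as `PointwiseGrowth.mono` requires. -/
theorem powWeight_div_fact_le (hp : 0 < p) (α : MIdx n) : powWeight p α.len / α.fact ≤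
    (Real.exp (1 / p) * (n + 1)) ^ α.len * ((α.len.factorial : ℝ) ^ (1 - 1 / p))⁻¹ := by
  have hf : (0 : ℝ) < α.len.factorial := by exact_mod_cast Nat.factorial_pos _
  have hα : (0 : ℝ) < α.fact := by exact_mod_cast α.fact_pos
  have h1 : (α.len.factorial : ℝ) ≤ (n + 1) ^ α.len * α.fact := by
    have : (α.len.factorial : ℝ) ≤ n ^ α.len * α.fact := by exact_mod_cast α.factorial_len_le
    refine this.trans ?_
    gcongr
    linarith
  have h2 : (α.len : ℝ) ^ α.len ≤ Real.exp α.len * α.len.factorial := by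
    have := Real.pow_div_factorial_le_exp (α.len : ℝ) (Nat.cast_nonneg _) α.len
    rwa [div_le_iff₀ hf] at this
  rw [Real.rpow_sub hf, Real.rpow_one, inv_div, powWeight_eq', mul_pow, ← Real.exp_nat_mul,
    div_le_iff₀ hα]
  calc ((α.len : ℝ) ^ α.len) ^ (1 / p) ≤ (Real.exp α.len * α.len.factorial) ^ (1 / p) := by gcongr
    _ = Real.exp (α.len * (1 / p)) * (α.len.factorial : ℝ) ^ (1 / p) := by
        rw [Real.mul_rpow (by positivity) hf.le, ← Real.exp_mul]
    _ ≤ Real.exp (α.len * (1 / p)) * (α.len.factorial : ℝ) ^ (1 / p) *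
        (((n + 1) ^ α.len * α.fact) / α.len.factorial) := by
        refine le_mul_of_one_le_right (by positivity) ?_
        rwa [one_le_div hf]
    _ = _ := by ring

theorem growthI_iff {a : MIdx n → Cn n → ℂ} : GrowthI p a ↔
    PointwiseGrowth p (fun α => ((α.len.factorial : ℝ) ^ (1 - 1 / p))⁻¹) a := by
  simp only [GrowthI, PointwiseGrowth, div_eq_mul_inv, mul_comm]

theorem growthII_iff {a : MIdx n → Cn n → ℂ} : GrowthII p a ↔
    PointwiseGrowth p (fun α => powWeight p α.len / α.fact) a := by
  simp only [GrowthII, PointwiseGrowth, powWeight, mul_assoc]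

theorem growthI_iff_growthII (hp : 0 < p) {a : MIdx n → Cn n → ℂ} :
    GrowthI p a ↔ GrowthII p a := by
  rw [growthI_iff, growthII_iff]
  refine ⟨PointwiseGrowth.mono one_pos fun α => ?_, PointwiseGrowth.mono (by positivity)
    (powWeight_div_fact_le hp)⟩
  rw [one_pow, one_mul]
  exact inv_factorial_rpow_le hp α

theorem growthI_iff_growthIII {a : MIdx n → Cn n → ℂ} (ha : ∀ α, Differentiable ℂ (a α)) :
    GrowthI p a ↔ GrowthIII p a := by
  rw [growthI_iff, pointwiseGrowth_iff_ptNorm ha]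
  simp only [GrowthIII, div_eq_mul_inv, mul_comm]

theorem growthII_iff_growthIV {a : MIdx n → Cn n → ℂ} (ha : ∀ α, Differentiable ℂ (a α)) :
    GrowthII p a ↔ GrowthIV p a := by
  rw [growthII_iff, pointwiseGrowth_iff_ptNorm ha]
  simp only [GrowthIV, powWeight, mul_assoc]

theorem growth_tfae (hp : 0 < p) {a : MIdx n → Cn n → ℂ} (ha : ∀ α, Differentiable ℂ (a α)) :
    List.TFAE [GrowthI p a, GrowthII p a, GrowthIII p a, GrowthIV p a] := by
  tfae_have 1 ↔ 2 := growthI_iff_growthII hp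
  tfae_have 1 ↔ 3 := growthI_iff_growthIII ha
  tfae_have 2 ↔ 4 := growthII_iff_growthIV ha
  tfae_finish

theorem OperatorD.pointwiseGrowth (hp : 0 < p) (P : OperatorD n p) :
    PointwiseGrowth p (fun α => powWeight p α.len / α.fact) P.coeff := by
  rw [← growthII_iff]
  have h := growth_tfae hp P.entire
  rcases P.growth with h1 | h1 | h1 | h1
  · exact (h.out 0 1).1 h1
  · exact h1
  · exact (h.out 2 1).1 h1
  · exact (h.out 3 1).1 h1

end Growth


/-! ### The inductive limit topology and its steps. -/

namespace SpaceA

variable {n : ℕ} {p : ℝ}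

theorem continuous_incl {τ : ℝ} (hτ : 0 < τ) : Continuous (incl hτ : BanachA n p τ → SpaceA n p) :=
  continuous_sInf_rng.2 fun _ ht => ht.2.2.2 τ hτ

/-- A linear map into a locally convex space is continuous on `A_p` if its restrictions to all
steps are. -/
theorem continuous_of_comp_incl {E : Type*} [AddCommGroup E] [Module ℂ E] [TopologicalSpace E]
    [IsTopologicalAddGroup E] [ContinuousSMul ℂ E] [LocallyConvexSpace ℝ E]
    (L : SpaceA n p →ₗ[ℂ] E)
    (h : ∀ (τ : ℝ) (hτ : 0 < τ), Continuous fun f : BanachA n p τ => L (incl hτ f)) :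
    Continuous L := by
  -- The topology induced by `L` is one of those whose infimum defines the topology of `A_p`.
  rw [continuous_iff_le_induced]
  refine sInf_le ⟨topologicalAddGroup_induced L, continuousSMul_induced L,
    LocallyConvexSpace.induced (L.restrictScalars ℝ), fun τ hτ => ?_⟩
  exact continuous_induced_rng.2 (h τ hτ)

/-- A linear endomorphism of `A_p` is continuous if it maps the steps continuously to `A_p`. -/
theorem continuous_endomorphism_of_comp_incl (L : SpaceA n p →ₗ[ℂ] SpaceA n p)
    (h : ∀ (τ : ℝ) (hτ : 0 < τ), Continuous fun f : BanachA n p τ => L (incl hτ f)) :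
    Continuous L := by
  -- Each competing topology `t` serves as the target in turn, so the infimum itself need not be
  -- shown to be locally convex.
  refine continuous_sInf_rng.2 fun t ht => ?_
  have h' := fun τ hτ => continuous_sInf_rng.1 (h τ hτ) t ht
  obtain ⟨h1, h2, h3, -⟩ := ht
  exact @continuous_of_comp_incl n p (SpaceA n p) _ _ t h1 h2 h3 L h'

end SpaceA

namespace BanachA

variable {n : ℕ} {p τ : ℝ}

theorem differentiable (f : BanachA n p τ) : Differentiable ℂ f := f.2.1

theorem norm_apply_le (f : BanachA n p τ) (z : Cn n) :
    ‖f z‖ ≤ ‖f‖ * Real.exp (τ * ‖z‖ ^ p) := by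
  have := f.weighted_le_norm z
  rwa [weighted, Real.exp_neg, ← div_eq_mul_inv, div_le_iff₀ (Real.exp_pos _)] at this

theorem norm_le_of_forall {f : BanachA n p τ} {M : ℝ}
    (h : ∀ z, ‖f z‖ ≤ M * Real.exp (τ * ‖z‖ ^ p)) : ‖f‖ ≤ M := by
  refine ciSup_le fun z => ?_
  rw [weighted, Real.exp_neg, ← div_eq_mul_inv, div_le_iff₀ (Real.exp_pos _)]
  exact h z

/-- An entire function with a growth bound, as an element of `A_{p,τ}`. -/
def ofBound (f : Cn n → ℂ) (hf : Differentiable ℂ f)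
    (h : ∃ M : ℝ, ∀ z, ‖f z‖ ≤ M * Real.exp (τ * ‖z‖ ^ p)) : BanachA n p τ :=
  ⟨f, hf, h.imp fun M hM => by
    rintro _ ⟨z, rfl⟩
    rw [weighted, Real.exp_neg, ← div_eq_mul_inv, div_le_iff₀ (Real.exp_pos _)]
    exact hM z⟩

@[simp] theorem ofBound_apply (f : Cn n → ℂ) (hf : Differentiable ℂ f)
    (h : ∃ M : ℝ, ∀ z, ‖f z‖ ≤ M * Real.exp (τ * ‖z‖ ^ p)) (z : Cn n) :
    ofBound f hf h z = f z := rfl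

@[simp] theorem add_apply (f g : BanachA n p τ) (z : Cn n) : (f + g) z = f z + g z := rfl

@[simp] theorem smul_apply (c : ℂ) (f : BanachA n p τ) (z : Cn n) : (c • f) z = c * f z := rfl

theorem coe_add (f g : BanachA n p τ) : ⇑(f + g) = ⇑f + ⇑g := rfl

theorem coe_smul (c : ℂ) (f : BanachA n p τ) : ⇑(c • f) = c • ⇑f := rfl

theorem mem_submoduleAUnion (hτ : 0 < τ) (f : BanachA n p τ) :
    ⇑f ∈ submoduleAUnion n p := ⟨τ, hτ, f.2⟩

/-- Evaluation at a point, as a continuous linear functional. -/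
def evalCLM (z : Cn n) : BanachA n p τ →L[ℂ] ℂ :=
  LinearMap.mkContinuous
    { toFun := fun f => f z, map_add' := fun _ _ => rfl, map_smul' := fun _ _ => rfl }
    (Real.exp (τ * ‖z‖ ^ p)) fun f => by
      rw [mul_comm]; exact f.norm_apply_le z

/-- Weierstrass M-test. The limit is built as the pointwise sum, so completeness of `A_{p,τ}` is not
needed; the tails of `u` bound the error in norm. -/
theorem exists_hasSum {ι : Type*} (hp : 0 ≤ p) (hτ : 0 ≤ τ) {t : ι → BanachA n p τ} {u : ι → ℝ}
    (hu : Summable u) (h : ∀ i, ‖t i‖ ≤ u i) :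
    ∃ g : BanachA n p τ, HasSum t g ∧ ∀ z, HasSum (fun i => t i z) (g z) := by
  have hb : ∀ z i, ‖t i z‖ ≤ u i * Real.exp (τ * ‖z‖ ^ p) := fun z i =>
    ((t i).norm_apply_le z).trans (by gcongr; exact h i)
  have hs : ∀ z, Summable fun i => t i z := fun z =>
    (hu.mul_right _).of_norm_bounded (hb z)
  have hd : Differentiable ℂ fun z => ∑' i, t i z := by
    refine differentiable_tsum_of_locally_bounded (fun i => (t i).differentiable) fun R =>
      ⟨_, hu.mul_right (Real.exp (τ * R ^ p)), fun i z hz => (hb z i).trans ?_⟩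
    have := (norm_nonneg _).trans (h i)
    gcongr
  have hM : ∀ z, ‖∑' i, t i z‖ ≤ (∑' i, u i) * Real.exp (τ * ‖z‖ ^ p) := fun z =>
    tsum_of_norm_bounded (hu.hasSum.mul_right _) (hb z)
  refine ⟨ofBound _ hd ⟨_, hM⟩, ?_, fun z => (hs z).hasSum⟩
  rw [HasSum, tendsto_iff_norm_sub_tendsto_zero]
  have h0 := hu.hasSum
  rw [HasSum, tendsto_iff_norm_sub_tendsto_zero] at h0
  refine squeeze_zero (fun _ => norm_nonneg _) (fun s => ?_) h0
  rw [norm_sub_rev, norm_sub_rev _ (∑' i, u i)]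
  refine norm_le_of_forall fun z => ?_
  have e1 : (ofBound _ hd ⟨_, hM⟩ - ∑ i ∈ s, t i : BanachA n p τ) z =
      (∑' i, t i z) - ∑ i ∈ s, t i z := by
    change evalCLM z (ofBound _ hd ⟨_, hM⟩ - ∑ i ∈ s, t i) = _
    rw [map_sub, map_sum]
    rfl
  have e2 : HasSum (fun i : ↥(sᶜ : Set ι) => t i z) ((∑' i, t i z) - ∑ i ∈ s, t i z) :=
    (s.hasSum_compl_iff (f := fun i => t i z)).2 (by simpa using (hs z).hasSum)
  have e3 : HasSum (fun i : ↥(sᶜ : Set ι) => u i) ((∑' i, u i) - ∑ i ∈ s, u i) :=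
    (s.hasSum_compl_iff (f := u)).2 (by simpa using hu.hasSum)
  rw [e1, ← e2.tsum_eq]
  refine (tsum_of_norm_bounded (e3.mul_right _) fun i => hb z i).trans ?_
  gcongr
  exact Real.le_norm_self _

end BanachA

/-! ### Continuous functionals on `A_p`, and bounded factorization through a step. -/

namespace SpaceA

variable {n : ℕ} {p : ℝ}

theorem differentiable (f : SpaceA n p) : Differentiable ℂ f := by
  obtain ⟨f, τ, _, hf⟩ := f
  exact hf.1

theorem exists_incl_eq (f : SpaceA n p) :
    ∃ (τ : ℝ) (hτ : 0 < τ) (g : BanachA n p τ), incl hτ g = f := by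
  obtain ⟨f, τ, hτ, hf⟩ := f
  exact ⟨τ, hτ, ⟨f, hf⟩, rfl⟩

theorem coe_add (f g : SpaceA n p) : ⇑(f + g) = ⇑f + ⇑g := rfl

theorem coe_smul (c : ℂ) (f : SpaceA n p) : ⇑(c • f) = c • ⇑f := rfl

/-- Evaluation at a point, as a linear functional. -/
def evalLM (z : Cn n) : SpaceA n p →ₗ[ℂ] ℂ where
  toFun f := f z
  map_add' _ _ := rfl
  map_smul' _ _ := rfl

theorem continuous_eval (z : Cn n) : Continuous fun f : SpaceA n p => f z :=
  continuous_of_comp_incl (evalLM z) fun τ _ => (BanachA.evalCLM (τ := τ) z).continuous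

open BoundedContinuousFunction in
/-- Evaluation along a sequence `z m`, weighted by `exp(-m|z m|^p)`, is a continuous map from `A_p`
to the bounded sequences. -/
theorem exists_continuousLinearMap_sequence (z : ℕ → Cn n) :
    ∃ S : SpaceA n p →L[ℂ] (ℕ →ᵇ ℂ), ∀ f m,
      S f m = f (z m) * (Real.exp (-(m * ‖z m‖ ^ p)) : ℝ) := by
  have bound : ∀ τ : ℝ, 0 < τ → ∃ K : ℝ, ∀ (f : BanachA n p τ) (m : ℕ),
      ‖f (z m) * (Real.exp (-(m * ‖z m‖ ^ p)) : ℝ)‖ ≤ K * ‖f‖ := by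
    intro τ hτ
    obtain ⟨N, hN⟩ := exists_nat_ge τ
    -- For `m ≥ τ` the weight beats the growth of `f`, giving the 1; the finitely many `m < N` are
    -- covered by the sum.
    refine ⟨1 + ∑ m ∈ Finset.range N, Real.exp (τ * ‖z m‖ ^ p), fun f m => ?_⟩
    have hx : 0 ≤ ‖z m‖ ^ p := Real.rpow_nonneg (norm_nonneg _) p
    rw [norm_mul, Complex.norm_real, Real.norm_eq_abs, Real.abs_exp]
    have h1 : ‖f (z m)‖ * Real.exp (-(m * ‖z m‖ ^ p)) ≤
        ‖f‖ * (Real.exp (τ * ‖z m‖ ^ p) * Real.exp (-(m * ‖z m‖ ^ p))) := by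
      rw [← mul_assoc]
      gcongr
      exact f.norm_apply_le _
    refine h1.trans ?_
    rw [mul_comm]
    gcongr
    rw [← Real.exp_add]
    rcases lt_or_ge m N with hm | hm
    · calc Real.exp (τ * ‖z m‖ ^ p + -(m * ‖z m‖ ^ p)) ≤ Real.exp (τ * ‖z m‖ ^ p) := by
            gcongr
            have : 0 ≤ (m : ℝ) * ‖z m‖ ^ p := by positivity
            linarith
        _ ≤ ∑ m ∈ Finset.range N, Real.exp (τ * ‖z m‖ ^ p) :=
            Finset.single_le_sum (f := fun m => Real.exp (τ * ‖z m‖ ^ p))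
              (fun _ _ => (Real.exp_pos _).le) (Finset.mem_range.2 hm)
        _ ≤ _ := by linarith
    · have hm' : τ ≤ m := hN.trans (by exact_mod_cast hm)
      calc Real.exp (τ * ‖z m‖ ^ p + -(m * ‖z m‖ ^ p)) ≤ 1 := by
            rw [Real.exp_le_one_iff]
            nlinarith
        _ ≤ _ := by
            have : 0 ≤ ∑ m ∈ Finset.range N, Real.exp (τ * ‖z m‖ ^ p) :=
              Finset.sum_nonneg fun _ _ => (Real.exp_pos _).le
            linarith
  have bound' : ∀ f : SpaceA n p, ∃ C, ∀ m,
      ‖f (z m) * (Real.exp (-(m * ‖z m‖ ^ p)) : ℝ)‖ ≤ C := by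
    intro f
    obtain ⟨τ, hτ, g, rfl⟩ := f.exists_incl_eq
    obtain ⟨K, hK⟩ := bound τ hτ
    exact ⟨_, hK g⟩
  let S : SpaceA n p →ₗ[ℂ] (ℕ →ᵇ ℂ) :=
    { toFun := fun f => BoundedContinuousFunction.ofNormedAddCommGroupDiscrete
        (fun m => f (z m) * (Real.exp (-(m * ‖z m‖ ^ p)) : ℝ)) (bound' f).choose
        (bound' f).choose_spec
      map_add' := fun f g => by ext m; exact add_mul _ _ _
      map_smul' := fun c f => by ext m; exact mul_assoc _ _ _ }
  refine ⟨⟨S, continuous_of_comp_incl S fun τ hτ => ?_⟩, fun f m => rfl⟩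
  obtain ⟨K, hK⟩ := bound τ hτ
  refine (LinearMap.mkContinuous (S ∘ₗ incl hτ) (max K 0) fun f => ?_).continuous
  refine (BoundedContinuousFunction.norm_le (by positivity)).2 fun m => (hK f m).trans ?_
  gcongr
  exact le_max_left _ _

/-- A continuous linear map to `A_p` from a normed space has its range in a fixed step, with a norm
bound. -/
theorem exists_bound_of_continuous {X : Type*} [NormedAddCommGroup X] [NormedSpace ℂ X]
    (F : X →L[ℂ] SpaceA n p) : ∃ m : ℕ, 0 < m ∧ ∀ (x : X) (z : Cn n),
      ‖F x z‖ ≤ m * ‖x‖ * Real.exp (m * ‖z‖ ^ p) := by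
  -- If every bound `m` fails at some `x_m`, `z_m`, then sampling along the `z_m` composed with `F`
  -- is a continuous map of normed spaces, and its finite norm contradicts the violations for large
  -- `m`.
  by_contra! H
  have H' : ∀ m : ℕ, ∃ (x : X) (z : Cn n),
      ((m + 1 : ℕ) : ℝ) * ‖x‖ * Real.exp ((m + 1 : ℕ) * ‖z‖ ^ p) < ‖F x z‖ :=
    fun m => H (m + 1) m.succ_pos
  choose x z hxz using H'
  -- The shift gives the point `z N` the sampling weight of index `N + 1`, the constant of its
  -- violation; index 0 merely repeats `z 0`.
  obtain ⟨S, hS⟩ := exists_continuousLinearMap_sequence (p := p) fun m => z (m - 1)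
  let G := S.comp F
  obtain ⟨N, hN⟩ := exists_nat_ge ‖G‖
  have h1 : ‖G (x N) (N + 1)‖ ≤ ‖G‖ * ‖x N‖ :=
    (BoundedContinuousFunction.norm_coe_le_norm _ _).trans (G.le_opNorm _)
  have h2 : G (x N) (N + 1) = F (x N) (z N) *
      (Real.exp (-((N + 1 : ℕ) * ‖z N‖ ^ p)) : ℝ) := hS _ _
  rw [h2, norm_mul, Complex.norm_real, Real.norm_eq_abs, Real.abs_exp, Real.exp_neg,
    ← div_eq_mul_inv, div_le_iff₀ (Real.exp_pos _)] at h1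
  have h3 := (hxz N).trans_le h1
  have h4 : ‖G‖ * ‖x N‖ * Real.exp ((N + 1 : ℕ) * ‖z N‖ ^ p) ≤
      ((N + 1 : ℕ) : ℝ) * ‖x N‖ * Real.exp ((N + 1 : ℕ) * ‖z N‖ ^ p) := by
    gcongr
    push_cast
    linarith
  exact absurd h3 (not_lt.2 h4)

end SpaceA


/-! ### Differential operators and endomorphisms of `A_p`. -/

section Operators

variable {n : ℕ} {p : ℝ}

/-- The weights of `a_α` and of `∂^α f` are reciprocal, and `ε = 1/(2K)` reduces `K^|α|` to
`2^(-|α|)`. The exponent `σ` depends on `τ` but not on `f`, which later gives continuity. -/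
theorem OperatorD.exists_norm_term_le (hp : 0 < p) (P : OperatorD n p) {τ : ℝ} (hτ : 0 < τ) :
    ∃ σ C : ℝ, 0 < σ ∧ 0 < C ∧ ∀ (f : BanachA n p τ) (α : MIdx n) (z : Cn n),
      ‖P.coeff α z * iterD α f z‖ ≤ C * ‖f‖ * (1 / 2) ^ α.len * Real.exp (σ * ‖z‖ ^ p) := by
  obtain ⟨K, hK1, hK⟩ := exists_norm_iterD_le n hp hτ.le
  have hK0 : 0 < K := one_pos.trans_le hK1
  obtain ⟨B, C, hB, hC, hP⟩ := P.pointwiseGrowth hp (1 / (2 * K)) (by positivity)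
  refine ⟨B + τ * 2 ^ p, C, by positivity, hC, fun f α z => ?_⟩
  have hα : (0 : ℝ) < α.fact := by exact_mod_cast α.fact_pos
  have hW := powWeight_pos p α.len
  rw [norm_mul]
  calc ‖P.coeff α z‖ * ‖iterD α f z‖
      ≤ (C * (powWeight p α.len / α.fact * (1 / (2 * K)) ^ α.len) * Real.exp (B * ‖z‖ ^ p)) *
        (‖f‖ * (α.fact / powWeight p α.len) * K ^ α.len * Real.exp (τ * 2 ^ p * ‖z‖ ^ p)) :=
        mul_le_mul (hP z α) (hK f ‖f‖ f.differentiable f.norm_apply_le α z) (norm_nonneg _)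
          (by positivity)
    _ = C * ‖f‖ * (1 / (2 * K) * K) ^ α.len *
        (powWeight p α.len / α.fact * (α.fact / powWeight p α.len)) *
        (Real.exp (B * ‖z‖ ^ p) * Real.exp (τ * 2 ^ p * ‖z‖ ^ p)) := by rw [mul_pow]; ring
    _ = _ := by
        rw [← Real.exp_add, ← add_mul, div_mul_div_cancel₀ hα.ne', div_self hW.ne', mul_one]
        congr 3
        field_simp

theorem OperatorD.exists_sums (hp : 0 < p) (P : OperatorD n p) (f : SpaceA n p) :
    ∃ g : SpaceA n p, P.SumsPointwise f g ∧ P.SumsInA f g := by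
  obtain ⟨τ, hτ, f, rfl⟩ := f.exists_incl_eq
  obtain ⟨σ, C, hσ, -, h⟩ := P.exists_norm_term_le hp hτ
  let t : MIdx n → BanachA n p σ := fun α =>
    BanachA.ofBound (fun z => P.coeff α z * iterD α f z)
      ((P.entire α).mul (iterD_differentiable α f.differentiable)) ⟨_, h f α⟩
  obtain ⟨g, hg, hg'⟩ := BanachA.exists_hasSum (t := t) hp.le hσ.le
    ((summable_pow_len n (by norm_num) (by norm_num)).mul_left (C * ‖f‖))
    fun α => BanachA.norm_le_of_forall (h f α)
  exact ⟨SpaceA.incl hσ g, hg', fun α => SpaceA.incl hσ (t α), fun α z => rfl,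
    hg.map (SpaceA.incl hσ) (SpaceA.continuous_incl hσ)⟩

theorem OperatorD.SumsPointwise.unique {P : OperatorD n p} {f g h : SpaceA n p}
    (hg : P.SumsPointwise f g) (hh : P.SumsPointwise f h) : g = h :=
  DFunLike.ext _ _ fun z => (hg z).unique (hh z)

theorem OperatorD.SumsPointwise.add {P : OperatorD n p} {f g f' g' : SpaceA n p}
    (h : P.SumsPointwise f g) (h' : P.SumsPointwise f' g') :
    P.SumsPointwise (f + f') (g + g') := fun z => by
  have := (h z).add (h' z)
  simp only [← mul_add] at this
  simpa only [SpaceA.coe_add, iterD_add _ f.differentiable f'.differentiable, Pi.add_apply]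

theorem OperatorD.SumsPointwise.smul {P : OperatorD n p} {f g : SpaceA n p}
    (h : P.SumsPointwise f g) (c : ℂ) : P.SumsPointwise (c • f) (c • g) := fun z => by
  have := (h z).mul_left c
  simp only [mul_left_comm c] at this
  simpa only [SpaceA.coe_smul, iterD_smul _ f.differentiable, Pi.smul_apply, smul_eq_mul]

/-- Linearity follows from uniqueness of pointwise sums; continuity, from boundedness of each step
`A_{p,τ}` into one step `A_{p,σ}`. -/
theorem OperatorD.exists_continuousLinearMap (hp : 0 < p) (P : OperatorD n p) :
    ∃ T : SpaceA n p →L[ℂ] SpaceA n p,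
      ∀ f : SpaceA n p, P.SumsPointwise f (T f) ∧ P.SumsInA f (T f) := by
  choose T hT hT' using P.exists_sums hp
  let L : SpaceA n p →ₗ[ℂ] SpaceA n p :=
    { toFun := T
      map_add' := fun f g => (hT _).unique ((hT f).add (hT g))
      map_smul' := fun c f => (hT _).unique ((hT f).smul c) }
  refine ⟨⟨L, SpaceA.continuous_endomorphism_of_comp_incl L fun τ hτ => ?_⟩,
    fun f => ⟨hT f, hT' f⟩⟩
  obtain ⟨σ, C, hσ, hC, h⟩ := P.exists_norm_term_le hp hτ
  have hS := summable_pow_len n (ε := 1 / 2) (by norm_num) (by norm_num)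
  have hb : ∀ (f : BanachA n p τ) z, ‖L (SpaceA.incl hτ f) z‖ ≤
      C * (∑' α : MIdx n, (1 / 2) ^ α.len) * ‖f‖ * Real.exp (σ * ‖z‖ ^ p) := fun f z => by
    refine (HasSum.norm_le_of_bounded (hT (SpaceA.incl hτ f) z)
      ((hS.hasSum.mul_left (C * ‖f‖)).mul_right _) (h f · z)).trans (le_of_eq ?_)
    ring
  let G : BanachA n p τ →ₗ[ℂ] BanachA n p σ :=
    { toFun := fun f => BanachA.ofBound (L (SpaceA.incl hτ f)) (SpaceA.differentiable _) ⟨_, hb f⟩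
      map_add' := fun f g => by
        refine DFunLike.ext _ _ fun z => ?_
        simp only [map_add, BanachA.ofBound_apply, BanachA.add_apply, SpaceA.coe_add, Pi.add_apply]
      map_smul' := fun c f => by
        refine DFunLike.ext _ _ fun z => ?_
        simp only [map_smul, BanachA.ofBound_apply, BanachA.smul_apply, SpaceA.coe_smul,
          Pi.smul_apply, smul_eq_mul, RingHom.id_apply] }
  exact (SpaceA.continuous_incl hσ).comp (G.mkContinuous _ fun f =>
    BanachA.norm_le_of_forall (hb f)).continuous

/-- The functional `f ↦ ∂^α f(z)` on `A_{p,τ}` is continuous. -/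
theorem exists_iterD_continuousLinearMap (hp : 0 < p) {τ : ℝ} (hτ : 0 ≤ τ) (α : MIdx n)
    (z : Cn n) : ∃ L : BanachA n p τ →L[ℂ] ℂ, ∀ f, L f = iterD α f z := by
  obtain ⟨K, -, hK⟩ := exists_norm_iterD_le n hp hτ
  refine ⟨LinearMap.mkContinuous
    { toFun := fun f => iterD α f z
      map_add' := fun f g => by
        rw [BanachA.coe_add, iterD_add _ f.differentiable g.differentiable, Pi.add_apply]
      map_smul' := fun c f => by
        rw [BanachA.coe_smul, iterD_smul _ f.differentiable, Pi.smul_apply]; rfl }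
    ((α.fact / powWeight p α.len) * K ^ α.len * Real.exp (τ * 2 ^ p * ‖z‖ ^ p)) fun f =>
      (hK f ‖f‖ f.differentiable f.norm_apply_le α z).trans (le_of_eq (by ring)), fun f => rfl⟩

theorem shiftPow_mem (hp : 0 < p) (z : Cn n) (α : MIdx n) :
    shiftPow z α ∈ submoduleAUnion n p := by
  obtain ⟨t, ht, h⟩ := norm_shiftPow_le (n := n) hp one_pos
  exact (BanachA.ofBound _ (shiftPow_differentiable z α)
    ⟨_, h t le_rfl z α⟩).mem_submoduleAUnion ht

/-- The shifted monomial `(w - z)^α` as an element of `A_p`. -/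
def SpaceA.shiftMonomial (hp : 0 < p) (z : Cn n) (α : MIdx n) : SpaceA n p :=
  ⟨shiftPow z α, shiftPow_mem hp z α⟩

theorem SpaceA.coe_shiftMonomial (hp : 0 < p) (z : Cn n) (α : MIdx n) :
    ⇑(SpaceA.shiftMonomial hp z α) = shiftPow z α := rfl

theorem SpaceA.shiftMonomial_eq_sum (hp : 0 < p) (z : Cn n) (α : MIdx n) :
    SpaceA.shiftMonomial hp z α = ∑ β ∈ Finset.Iic α,
      ((α.fact / (MIdx.fact (α - β) * MIdx.fact β) : ℂ) * zpowIdx (-z) (α - β)) •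
        SpaceA.monomial hp β := by
  refine DFunLike.ext _ _ fun w => ?_
  change zpowIdx (w - z) α = evalLM w _
  rw [sub_eq_add_neg, zpowIdx_add, map_sum]
  refine Finset.sum_congr rfl fun β _ => ?_
  rw [map_smul, smul_eq_mul, mul_assoc]
  rfl

/-- The Taylor expansion of `f` at `z` converges to `f` in `A_p`. -/
theorem SpaceA.hasSum_taylor (hp : 0 < p) (f : SpaceA n p) (z : Cn n) :
    HasSum (fun α : MIdx n => (iterD α f z / α.fact) • SpaceA.shiftMonomial hp z α) f := by
  obtain ⟨τ, hτ, f, rfl⟩ := f.exists_incl_eq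
  obtain ⟨K, hK1, hK⟩ := exists_norm_iterD_le n hp hτ.le
  have hK0 : 0 < K := one_pos.trans_le hK1
  -- This `δ` offsets the factor `K^|α|` in the derivatives of `f`, making the Taylor terms
  -- geometric in the single step `A_{p,t}`.
  obtain ⟨t, ht, hδ⟩ := norm_shiftPow_le (n := n) hp (δ := 1 / (2 * K)) (by positivity)
  let m : MIdx n → BanachA n p t := fun α =>
    BanachA.ofBound _ (shiftPow_differentiable z α) ⟨_, hδ t le_rfl z α⟩
  have hm : ∀ α, ‖m α‖ ≤ _ := fun α => BanachA.norm_le_of_forall (hδ t le_rfl z α)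
  let s : MIdx n → BanachA n p t := fun α => (iterD α f z / α.fact) • m α
  have hs : ∀ α, ‖s α‖ ≤ 2 * ‖f‖ * Real.exp (τ * 2 ^ p * ‖z‖ ^ p) * Real.exp (t * ‖z‖ ^ p) *
      (1 / 2) ^ α.len := fun α => by
    have hα : (0 : ℝ) < α.fact := by exact_mod_cast α.fact_pos
    have hW := powWeight_pos p α.len
    rw [norm_smul, norm_div, Complex.norm_natCast]
    calc ‖iterD α f z‖ / α.fact * ‖m α‖
        ≤ (‖f‖ * (α.fact / powWeight p α.len) * K ^ α.len * Real.exp (τ * 2 ^ p * ‖z‖ ^ p)) /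
          α.fact * (2 * (1 / (2 * K)) ^ α.len * powWeight p α.len * Real.exp (t * ‖z‖ ^ p)) := by
          gcongr
          · exact hK f ‖f‖ f.differentiable f.norm_apply_le α z
          · exact hm α
      _ = 2 * ‖f‖ * Real.exp (τ * 2 ^ p * ‖z‖ ^ p) * Real.exp (t * ‖z‖ ^ p) *
          (1 / (2 * K) * K) ^ α.len := by
          rw [mul_pow]
          field_simp
      _ = _ := by
          congr 2
          field_simp
  obtain ⟨g, hg, -⟩ := BanachA.exists_hasSum hp.le ht.le
    ((summable_pow_len n (by norm_num) (by norm_num)).mul_left _) hs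
  -- The functionals `∂^β` at `z` are continuous on the step and pick out one Taylor term, so `g`
  -- and `f` have the same derivatives at `z`.
  have hfg : ⇑g = ⇑f := by
    refine eq_of_iterD_eq (z := z) g.differentiable f.differentiable fun β => ?_
    obtain ⟨L, hL⟩ := exists_iterD_continuousLinearMap (n := n) hp ht.le β z
    have h1 := hg.mapL L
    rw [hL] at h1
    have h2 : ∀ α, L (s α) = if α = β then iterD β f z else 0 := fun α => by
      rw [map_smul, hL, smul_eq_mul]
      change _ * iterD β (shiftPow z α) z = _
      rw [iterD_shiftPow_self]
      rcases eq_or_ne α β with rfl | h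
      · have hα : (α.fact : ℂ) ≠ 0 := by exact_mod_cast α.fact_pos.ne'
        simp [hα]
      · simp [h, h.symm]
    simp only [h2] at h1
    exact h1.unique (hasSum_ite_eq β _)
  have e : SpaceA.incl hτ f = SpaceA.incl ht g := DFunLike.coe_injective hfg.symm
  rw [e]
  have := hg.map (SpaceA.incl ht) (SpaceA.continuous_incl ht)
  convert this using 2 with α
  rw [Function.comp_apply, ← e]
  rfl

/-- The coefficients of the differential operator that represents a map `F` of `A_p`. -/
def opCoeff (hp : 0 < p) (F : SpaceA n p →L[ℂ] SpaceA n p) (α : MIdx n) (z : Cn n) : ℂ :=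
  (α.fact : ℂ)⁻¹ * F (SpaceA.shiftMonomial hp z α) z

variable (hp : 0 < p) (F : SpaceA n p →L[ℂ] SpaceA n p)

theorem opCoeff_eq_sum (α : MIdx n) (z : Cn n) : opCoeff hp F α z =
    ∑ β ∈ Finset.Iic α, zpowIdx (-z) (α - β) / ((MIdx.fact (α - β) : ℂ) * (MIdx.fact β : ℂ)) *
      F (SpaceA.monomial hp β) z := by
  have hα : (α.fact : ℂ) ≠ 0 := by exact_mod_cast α.fact_pos.ne'
  rw [opCoeff, SpaceA.shiftMonomial_eq_sum, map_sum]
  change _ * SpaceA.evalLM z _ = _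
  rw [map_sum, Finset.mul_sum]
  refine Finset.sum_congr rfl fun β _ => ?_
  rw [map_smul, map_smul, smul_eq_mul]
  change _ * (_ * F (SpaceA.monomial hp β) z) = _
  field_simp

theorem opCoeff_differentiable (α : MIdx n) : Differentiable ℂ (opCoeff hp F α) := by
  rw [funext (opCoeff_eq_sum hp F α)]
  have h1 : ∀ β, Differentiable ℂ fun z : Cn n => zpowIdx (-z) β := fun β => by
    unfold zpowIdx
    fun_prop
  have h2 := fun β => (F (SpaceA.monomial hp β)).differentiable
  simp only [div_eq_mul_inv]
  exact Differentiable.fun_sum fun β _ => ((h1 _).mul_const _).mul (h2 β)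

/-- Given `ε`, all monomials `(w - z)^α` lie in one step `A_{p,t}`, on which `F` has a bound `m`;
both `t` and `m` are independent of `z` and `α`. -/
theorem opCoeff_growth :
    PointwiseGrowth p (fun α => powWeight p α.len / α.fact) (opCoeff hp F) := by
  intro ε hε
  obtain ⟨t, ht, hδ⟩ := norm_shiftPow_le (n := n) hp hε
  let G : BanachA n p t →L[ℂ] SpaceA n p :=
    F.comp ⟨SpaceA.incl ht, SpaceA.continuous_incl ht⟩
  obtain ⟨m, hm, hG⟩ := SpaceA.exists_bound_of_continuous G
  have hm' : (0 : ℝ) < m := by exact_mod_cast hm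
  refine ⟨t + m, 2 * m, by positivity, by positivity, fun z α => ?_⟩
  have hα : (0 : ℝ) < α.fact := by exact_mod_cast α.fact_pos
  let s : BanachA n p t := BanachA.ofBound _ (shiftPow_differentiable z α) ⟨_, hδ t le_rfl z α⟩
  have hs : ‖s‖ ≤ _ := BanachA.norm_le_of_forall (hδ t le_rfl z α)
  have h1 : ‖F (SpaceA.shiftMonomial hp z α) z‖ ≤ m * ‖s‖ * Real.exp (m * ‖z‖ ^ p) := hG s z
  rw [opCoeff, norm_mul, norm_inv, Complex.norm_natCast]
  calc (α.fact : ℝ)⁻¹ * ‖F (SpaceA.shiftMonomial hp z α) z‖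
      ≤ (α.fact : ℝ)⁻¹ * (m * (2 * ε ^ α.len * powWeight p α.len * Real.exp (t * ‖z‖ ^ p)) *
        Real.exp (m * ‖z‖ ^ p)) := by
        gcongr
        refine h1.trans ?_
        gcongr
    _ = _ := by
        rw [add_mul, Real.exp_add]
        ring

/-- The differential operator that represents a continuous endomorphism of `A_p`. -/
def operatorOf : OperatorD n p where
  coeff := opCoeff hp F
  entire := opCoeff_differentiable hp F
  growth := Or.inr (Or.inl (growthII_iff.2 (opCoeff_growth hp F)))

theorem operatorOf_sumsPointwise (f : SpaceA n p) : (operatorOf hp F).SumsPointwise f (F f) := by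
  intro z
  have h := ((SpaceA.hasSum_taylor hp f z).map F F.continuous).map (SpaceA.evalLM z)
    (SpaceA.continuous_eval z)
  change HasSum _ (SpaceA.evalLM z (F f))
  convert h using 2 with α
  rw [Function.comp_apply, Function.comp_apply, map_smul, map_smul, smul_eq_mul]
  change (α.fact : ℂ)⁻¹ * F (SpaceA.shiftMonomial hp z α) z * _ =
    _ * F (SpaceA.shiftMonomial hp z α) z
  ring

/-- At `w = z`, the series for `(w - z)^α` reduces to the single term `α! a_α(z)`. -/
theorem eq_operatorOf (Q : OperatorD n p) (hQ : ∀ f : SpaceA n p, Q.SumsPointwise f (F f)) :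
    Q = operatorOf hp F := by
  have h : Q.coeff = opCoeff hp F := by
    ext α z
    have h1 := hQ (SpaceA.shiftMonomial hp z α) z
    simp only [SpaceA.coe_shiftMonomial, iterD_shiftPow_self, mul_ite, mul_zero] at h1
    have h2 : HasSum (fun β : MIdx n => if β = α then Q.coeff β z * (α.fact : ℂ) else 0)
        (Q.coeff α z * α.fact) := by
      have := hasSum_ite_eq α (Q.coeff α z * (α.fact : ℂ))
      convert this using 2 with β
      split_ifs with hβ
      · rw [hβ]
      · rfl
    have hα : (α.fact : ℂ) ≠ 0 := by exact_mod_cast α.fact_pos.ne'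
    rw [opCoeff, h1.unique h2]
    field_simp
  cases Q
  simp only at h
  subst h
  rfl

end Operators

end

theorem theorem1 (n : ℕ) (p : ℝ) (hp : 0 < p) :
    -- the four growth conditions are equivalent
    (∀ a : MIdx n → Cn n → ℂ, (∀ α, Differentiable ℂ (a α)) →
      List.TFAE [GrowthI p a, GrowthII p a, GrowthIII p a, GrowthIV p a]) ∧
    -- (i) every operator in `D_p` acts as a continuous linear endomorphism of `A_p`
    (∀ P : OperatorD n p, ∃ T : SpaceA n p →L[ℂ] SpaceA n p,
      ∀ f : SpaceA n p, P.SumsPointwise f (T f) ∧ P.SumsInA f (T f)) ∧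
    -- (ii) every continuous linear endomorphism is given by a unique operator in `D_p`
    (∀ F : SpaceA n p →L[ℂ] SpaceA n p, ∃ P : OperatorD n p,
      (∀ f : SpaceA n p, P.SumsPointwise f (F f) ∧ P.SumsInA f (F f)) ∧
      (∀ Q : OperatorD n p, (∀ f : SpaceA n p, Q.SumsPointwise f (F f)) → Q = P) ∧
      ∀ (α : MIdx n) (z : Cn n), P.coeff α z =
        ∑ β ∈ Finset.Iic α, zpowIdx (-z) (α - β) / ((MIdx.fact (α - β) : ℂ) * (MIdx.fact β : ℂ)) *
          F (SpaceA.monomial hp β) z) := by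
  refine ⟨fun a ha => growth_tfae hp ha, fun P => P.exists_continuousLinearMap hp, fun F =>
    ⟨operatorOf hp F, fun f => ?_, eq_operatorOf hp F, opCoeff_eq_sum hp F⟩⟩
  have hF := operatorOf_sumsPointwise hp F f
  -- Convergence in `A_p` comes from (i); its sum `T f` is `F f` because pointwise sums are unique.
  obtain ⟨T, hT⟩ := (operatorOf hp F).exists_continuousLinearMap hp
  exact ⟨hF, (hT f).1.unique hF ▸ (hT f).2⟩
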